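/- Let $X$ be a CAT(0) cube complex, i.e. a simply connected cube complex (in which any two cubes that meet intersect in a common face) such that the link of every $0$-cube is a flag complex. Equip $X$ with its $\ell_1$-metric (the length metric that restricts to the $\ell_1$-metric on each cube), and its $1$-skeleton $G(X)$ with the path metric. An isometric embedding of $X$ in a cube complex $Y$ is a combinatorial map $X\to Y$ (mapping each cube isometrically onto a cube, and $0$-cubes to $0$-cubes) which preserves the $\ell_1$-distance of any two points; an isometric embedding of a graph is a map of the vertices which preserves path distances. The crossing graph $\Gamma_\#(X)$ has the hyperplanes of $X$ as its vertices, and two hyperplanes $H,H'$ are adjacent if and only if they cross, i.e. each halfspace of $H$ meets each halfspace of $H'$. Then for every integer $k\ge 0$ the following are equivalent: (i) $X$ embeds isometrically in a Cartesian product of at most $k$ trees; (ii) $G(X)$ embeds isometrically in a Cartesian product of at most $k$ trees; (iii) $\Gamma_\#(X)$ is $k$-colourable, i.e. $\chi(\Gamma_\#(X))\le k$. Consequently, if $\tau(X)$ and $\tau(G(X))$ denote the least number of trees in a finite Cartesian product of trees in which $X$, respectively $G(X)$, embeds isometrically ($\infty$ if there is none), then $$\tau(X)=\tau(G(X))=\chi(\Gamma_\#(X)),$$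 where $\chi$ is $\infty$ if no finite colouring exists. (The product of no trees is a point.) -/

import Mathlib

universe u v

/-! ## Cube complexes -/

/-- The (vertex sets of the nonempty) faces of the standard cube with vertex set `{0,1}^d`:
some coordinates, those in `S`, are fixed, the others are free. -/
def IsCubeFace {d : ℕ} (F : Set (Fin d → Bool)) : Prop :=
  ∃ (S : Set (Fin d)) (c : Fin d → Bool), F = {b | ∀ i ∈ S, b i = c i}

/-- `φ` identifies the vertices of the standard `d`-cube with a set of vertices in such a way that
the members of `cubes` inside this set are exactly the faces of the `d`-cube. -/
def IsCubeChart {V : Type u} (cubes : Set (Set V)) {d : ℕ} (φ : (Fin d → Bool) → V) : Prop :=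
  Function.Injective φ ∧ ∀ τ ⊆ Set.range φ, (τ ∈ cubes ↔ IsCubeFace (φ ⁻¹' τ))

/-- A cube complex with set of 0-cubes `V`. Any two cubes that meet do so in a common face, so a
cube is determined by its set of vertices; `cubes` is the collection of these vertex sets. -/
structure CubeComplex (V : Type u) where
  cubes : Set (Set V)
  singleton_mem : ∀ v : V, {v} ∈ cubes
  exists_chart : ∀ σ ∈ cubes, ∃ (d : ℕ) (φ : (Fin d → Bool) → V),
    IsCubeChart cubes φ ∧ Set.range φ = σ
  inter_mem : ∀ σ ∈ cubes, ∀ τ ∈ cubes, (σ ∩ τ).Nonempty → σ ∩ τ ∈ cubes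

namespace CubeComplex

variable {V : Type u} (X : CubeComplex V)

/-- A parametrisation of a `d`-cube of `X` by the standard `d`-cube. -/
def IsChart {d : ℕ} (φ : (Fin d → Bool) → V) : Prop := IsCubeChart X.cubes φ

/-- The 1-skeleton: two distinct 0-cubes are adjacent if they span a 1-cube. -/
def oneSkeleton : SimpleGraph V where
  Adj x y := x ≠ y ∧ ({x, y} : Set V) ∈ X.cubes
  symm := ⟨fun x y h => ⟨h.1.symm, by rw [Set.pair_comm]; exact h.2⟩⟩
  loopless := ⟨fun _ h => h.1 rfl⟩

/-- `a, b, c, d` are, in this cyclic order, the four vertices of a 2-cube. -/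
def IsTwoCube (a b c d : V) : Prop :=
  a ≠ c ∧ b ≠ d ∧ X.oneSkeleton.Adj a b ∧ X.oneSkeleton.Adj b c ∧
    X.oneSkeleton.Adj c d ∧ X.oneSkeleton.Adj d a ∧ ({a, b, c, d} : Set V) ∈ X.cubes

/-! ## CAT(0) cube complexes -/

/-- The simplices of the link of `x`. The vertices of the link are the 1-cubes at `x`, which are
recorded by their other endpoints. A cube at `x` gives the simplex of all its 1-cubes at `x`
(the 0-cube `x` itself gives the empty simplex). -/
def link (x : V) : Set (Set V) :=
  {s | ∃ σ ∈ X.cubes, x ∈ σ ∧ s = {y | y ∈ σ ∧ X.oneSkeleton.Adj x y}}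

/-- All links are flag complexes: every finite set of pairwise adjacent vertices of the link
spans a simplex (for `y = z` the hypothesis says that `y` is a vertex of the link). -/
def HasFlagLinks : Prop :=
  ∀ (x : V) (s : Finset V),
    (∀ y ∈ s, ∀ z ∈ s, ({y, z} : Set V) ∈ X.link x) → (s : Set V) ∈ X.link x

/-- Homotopy, relative to the endpoints, of edge paths: it is generated by
the removal of backtracks and by pushing a path across a 2-cube. -/
inductive Homotopic : ∀ {x y : V}, X.oneSkeleton.Walk x y → X.oneSkeleton.Walk x y → Prop
  | refl {x y : V} (p : X.oneSkeleton.Walk x y) : Homotopic p p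
  | symm {x y : V} {p q : X.oneSkeleton.Walk x y} : Homotopic p q → Homotopic q p
  | trans {x y : V} {p q r : X.oneSkeleton.Walk x y} :
      Homotopic p q → Homotopic q r → Homotopic p r
  | cons {x y z : V} (h : X.oneSkeleton.Adj x y) {p q : X.oneSkeleton.Walk y z} :
      Homotopic p q → Homotopic (SimpleGraph.Walk.cons h p) (SimpleGraph.Walk.cons h q)
  | backtrack {x y z : V} (h : X.oneSkeleton.Adj x y) (p : X.oneSkeleton.Walk x z) :
      Homotopic (SimpleGraph.Walk.cons h (SimpleGraph.Walk.cons h.symm p)) p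
  | square {a b c d z : V} (hab : X.oneSkeleton.Adj a b) (hbc : X.oneSkeleton.Adj b c)
      (had : X.oneSkeleton.Adj a d) (hdc : X.oneSkeleton.Adj d c)
      (p : X.oneSkeleton.Walk c z) : X.IsTwoCube a b c d →
      Homotopic (SimpleGraph.Walk.cons hab (SimpleGraph.Walk.cons hbc p))
        (SimpleGraph.Walk.cons had (SimpleGraph.Walk.cons hdc p))

/-- `X` is nonempty, connected, and its (edge-path) fundamental group is trivial. -/
def IsSimplyConnected : Prop :=
  X.oneSkeleton.Connected ∧
    ∀ (x : V) (p : X.oneSkeleton.Walk x x), X.Homotopic p SimpleGraph.Walk.nil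

/-- A cube complex is CAT(0) if it is simply connected and its links are flag complexes. -/
def IsCAT0 : Prop := X.IsSimplyConnected ∧ X.HasFlagLinks

/-! ## Hyperplanes and the crossing graph -/

/-- Two 1-cubes are opposite if they are opposite sides of a 2-cube. -/
def Opposite (e f : X.oneSkeleton.edgeSet) : Prop :=
  ∃ a b c d : V, X.IsTwoCube a b c d ∧ (e : Sym2 V) = s(a, b) ∧ (f : Sym2 V) = s(d, c)

/-- Hyperplanes, as classes of parallel 1-cubes: parallelism is the equivalence relation generated
by being opposite in a 2-cube. (The geometric hyperplane is the union of the midcubes that meet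
the 1-cubes of the class.) -/
def Hyperplane : Type u := Quot X.Opposite

/-- The set of 1-cubes dual to a hyperplane. -/
def dualEdges (H : X.Hyperplane) : Set (Sym2 V) :=
  {e | ∃ h : e ∈ X.oneSkeleton.edgeSet, (Quot.mk X.Opposite ⟨e, h⟩ : X.Hyperplane) = H}

/-- The halfspaces of `H` (as sets of 0-cubes): the connected components of what remains after the
1-cubes dual to `H` have been cut. -/
def halfspaces (H : X.Hyperplane) : Set (Set V) :=
  {A | ∃ C : (X.oneSkeleton.deleteEdges (X.dualEdges H)).ConnectedComponent, A = C.supp}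

/-- Two hyperplanes cross if all their quarter-spaces are nonempty. -/
def Crosses (H K : X.Hyperplane) : Prop :=
  ∀ A ∈ X.halfspaces H, ∀ B ∈ X.halfspaces K, (A ∩ B).Nonempty

/-- The crossing graph: its vertices are the hyperplanes, two of them being adjacent if they
cross. -/
def crossingGraph : SimpleGraph X.Hyperplane where
  Adj H K := H ≠ K ∧ X.Crosses H K
  symm := ⟨fun _ _ h =>
    ⟨h.1.symm, fun A hA B hB => by rw [Set.inter_comm]; exact h.2 B hB A hA⟩⟩
  loopless := ⟨fun _ h => h.1 rfl⟩

/-! ## The geometric realization and its `ℓ¹`-metric -/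

open Classical in
/-- The point with coordinates `x ∈ [0,1]^d` of the cube parametrised by `φ`, recorded by its
multilinear barycentric coordinates: the vertex `φ b` gets the weight
`∏ i, (if b i then x i else 1 - x i)`, and all other vertices get weight `0`. -/
noncomputable def cubeWeight {V : Type u} {d : ℕ} (φ : (Fin d → Bool) → V)
    (x : Fin d → unitInterval) (v : V) : ℝ :=
  ∑ b : Fin d → Bool, if φ b = v then ∏ i, (if b i then (x i : ℝ) else 1 - (x i : ℝ)) else 0

/-- The points of the cube complex `X`. Points of different cubes are identified when they are the
same point of a common face, that is, when they have the same barycentric coordinates. -/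
@[ext] structure Realization where
  weight : V → ℝ
  exists_weight : ∃ (d : ℕ) (φ : (Fin d → Bool) → V) (x : Fin d → unitInterval),
    X.IsChart φ ∧ weight = cubeWeight φ x

/-- The point with coordinates `x` of the cube parametrised by `φ`. -/
noncomputable def point {d : ℕ} (φ : (Fin d → Bool) → V) (hφ : X.IsChart φ)
    (x : Fin d → unitInterval) : X.Realization :=
  ⟨cubeWeight φ x, d, φ, x, hφ, rfl⟩

/-- `X.Chain p q r`: there are points `p = p₀, p₁, …, pₙ = q` such that any two consecutive ones
lie in a common cube, and the `ℓ¹`-distances in these cubes add up to `r`. -/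
inductive Chain : X.Realization → X.Realization → ℝ → Prop
  | refl (p : X.Realization) : Chain p p 0
  | step {d : ℕ} (φ : (Fin d → Bool) → V) (hφ : X.IsChart φ) (x y : Fin d → unitInterval)
      {q : X.Realization} {r : ℝ} : Chain (X.point φ hφ y) q r →
      Chain (X.point φ hφ x) q ((∑ i, |(x i : ℝ) - (y i : ℝ)|) + r)

variable {X}

theorem Chain.trans {p q s : X.Realization} {r t : ℝ} (h : X.Chain p q r) (h' : X.Chain q s t) :
    X.Chain p s (r + t) := by
  induction h with
  | refl p => simpa using h'
  | step φ hφ x y _ ih => rw [add_assoc]; exact Chain.step φ hφ x y (ih h')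

theorem Chain.reverse {p q : X.Realization} {r : ℝ} (h : X.Chain p q r) : X.Chain q p r := by
  induction h with
  | refl p => exact Chain.refl p
  | step φ hφ x y _ ih =>
    have h1 := ih.trans (Chain.step φ hφ y x (Chain.refl _))
    simpa [abs_sub_comm, add_comm] using h1

variable (X)

/-- The `ℓ¹`-metric (wall-metric): the length metric which is the `ℓ¹`-metric on each cube,
that is, the infimum of the lengths of all chains. -/
noncomputable instance : PseudoEMetricSpace X.Realization where
  edist p q := ⨅ (r : ℝ) (_ : X.Chain p q r), ENNReal.ofReal r
  edist_self p := by
    refine le_antisymm ?_ bot_le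
    refine (iInf₂_le (0 : ℝ) (Chain.refl p)).trans ?_
    simp
  edist_comm p q := le_antisymm
    (le_iInf₂ fun r h => iInf₂_le r h.reverse) (le_iInf₂ fun r h => iInf₂_le r h.reverse)
  edist_triangle p q s := by
    refine ENNReal.le_of_forall_pos_le_add fun ε hε hlt => ?_
    have key : ∀ a b : X.Realization, (⨅ (r : ℝ) (_ : X.Chain a b r), ENNReal.ofReal r) < ⊤ →
        ∃ r, X.Chain a b r ∧ ENNReal.ofReal r ≤
          (⨅ (r : ℝ) (_ : X.Chain a b r), ENNReal.ofReal r) + (ε / 2 : NNReal) := by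
      intro a b hab
      have h1 := ENNReal.lt_add_right hab.ne
        (b := ((ε / 2 : NNReal) : ENNReal)) (by simpa using hε.ne')
      simp only [iInf_lt_iff] at h1
      obtain ⟨r, hr, h2⟩ := h1
      exact ⟨r, hr, h2.le⟩
    obtain ⟨r, hr, h1⟩ := key p q (lt_of_le_of_lt le_self_add hlt)
    obtain ⟨t, ht, h2⟩ := key q s (lt_of_le_of_lt le_add_self hlt)
    refine (iInf₂_le (r + t) (hr.trans ht)).trans ?_
    refine ENNReal.ofReal_add_le.trans ((add_le_add h1 h2).trans (le_of_eq ?_))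
    rw [add_add_add_comm, ← ENNReal.coe_add, add_halves]

/-- A map between cube complexes is combinatorial if it maps each cube isometrically (in the
coordinates of a chart: identically) onto a cube of the target, vertices going to vertices. -/
def IsCombinatorial {V : Type u} {W : Type v} (X : CubeComplex V) (Y : CubeComplex W)
    (F : X.Realization → Y.Realization) : Prop :=
  ∃ f : V → W, ∀ (d : ℕ) (φ : (Fin d → Bool) → V) (hφ : X.IsChart φ),
    ∃ hfφ : Y.IsChart (f ∘ φ), ∀ x : Fin d → unitInterval,
      F (X.point φ hφ x) = Y.point (f ∘ φ) hfφ x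

/-- `X` isometrically embeds in `Y`: some combinatorial map preserves the `ℓ¹`-distance of any
two points. -/
def IsometricallyEmbeds {V : Type u} {W : Type v} (X : CubeComplex V) (Y : CubeComplex W) : Prop :=
  ∃ F : X.Realization → Y.Realization, IsCombinatorial X Y F ∧ Isometry F

/-! ## Graphs as 1-dimensional complexes, and products -/

/-- A simple graph as a cube complex of dimension at most one. -/
def ofGraph {W : Type u} (G : SimpleGraph W) : CubeComplex W where
  cubes := {σ | (∃ v, σ = {v}) ∨ ∃ v w, G.Adj v w ∧ σ = {v, w}}
  singleton_mem v := Or.inl ⟨v, rfl⟩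
  exists_chart := by
    rintro σ (⟨v, rfl⟩ | ⟨v, w, hvw, rfl⟩)
    · refine ⟨0, fun _ => v, ⟨fun a b _ => Subsingleton.elim a b, fun τ hτ => ?_⟩, by simp⟩
      have hτ' : τ ⊆ {v} := by simpa using hτ
      constructor
      · intro h
        refine ⟨∅, fun _ => false, ?_⟩
        have : v ∈ τ := by
          rcases Set.subset_singleton_iff_eq.1 hτ' with rfl | rfl
          · rcases h with ⟨x, hx⟩ | ⟨x, y, _, hx⟩
            · exact absurd hx.symm (Set.singleton_ne_empty x)
            · exact absurd hx.symm (Set.insert_nonempty x _).ne_empty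
          · rfl
        ext b
        simp [this]
      · rintro ⟨S, c, h⟩
        have hc : c ∈ (fun _ : Fin 0 → Bool => v) ⁻¹' τ := by
          rw [h]; exact fun i _ => rfl
        exact Or.inl ⟨v, subset_antisymm hτ' (by simpa using hc)⟩
    · have hr : Set.range (fun b : Fin 1 → Bool => if b 0 then w else v) = {v, w} := by
        ext z
        constructor
        · rintro ⟨b, rfl⟩
          by_cases hb : b 0 <;> simp [hb]
        · rintro (rfl | rfl)
          · exact ⟨fun _ => false, by simp⟩
          · exact ⟨fun _ => true, by simp⟩
      refine ⟨1, fun b => if b 0 then w else v, ⟨?_, fun τ hτ => ?_⟩, hr⟩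
      · intro a b hab
        funext i
        rw [Fin.eq_zero i]
        by_cases ha : a 0 <;> by_cases hb : b 0 <;> simp_all [hvw.ne, hvw.ne.symm]
      · rw [hr] at hτ
        constructor
        · intro h
          by_cases hv : v ∈ τ <;> by_cases hw : w ∈ τ
          · refine ⟨∅, fun _ => false, ?_⟩
            ext b
            by_cases hb : b 0 <;> simp [hb, hv, hw]
          · refine ⟨Set.univ, fun _ => false, ?_⟩
            ext b
            by_cases hb : b 0 <;> simp [hb, hv, hw]
          · refine ⟨Set.univ, fun _ => true, ?_⟩
            ext b
            by_cases hb : b 0 <;> simp [hb, hv, hw]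
          · have he : τ = ∅ := by
              ext z
              simp only [Set.mem_empty_iff_false, iff_false]
              intro hz
              rcases hτ hz with rfl | rfl
              · exact hv hz
              · exact hw hz
            subst he
            rcases h with ⟨x, hx⟩ | ⟨x, y, _, hx⟩
            · exact absurd hx.symm (Set.singleton_ne_empty x)
            · exact absurd hx.symm (Set.insert_nonempty x _).ne_empty
        · rintro ⟨S, c, h⟩
          have hc : c ∈ (fun b : Fin 1 → Bool => if b 0 then w else v) ⁻¹' τ := by
            rw [h]; exact fun i _ => rfl
          by_cases hv : v ∈ τ <;> by_cases hw : w ∈ τ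
          · exact Or.inr ⟨v, w, hvw, subset_antisymm hτ (by
              rintro z (rfl | rfl) <;> assumption)⟩
          · refine Or.inl ⟨v, subset_antisymm (fun z hz => ?_) (by simpa using hv)⟩
            rcases hτ hz with rfl | rfl
            · rfl
            · exact absurd hz hw
          · refine Or.inl ⟨w, subset_antisymm (fun z hz => ?_) (by simpa using hw)⟩
            rcases hτ hz with rfl | rfl
            · exact absurd hz hv
            · rfl
          · exfalso
            simp only [Set.mem_preimage] at hc
            by_cases hb : c 0 <;> simp_all
  inter_mem := by
    have aux : ∀ τ : Set W, ∀ v, (({v} : Set W) ∩ τ).Nonempty → {v} ∩ τ = {v} := by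
      rintro τ v ⟨z, hz, hz'⟩
      rw [Set.mem_singleton_iff] at hz
      subst hz
      simpa using hz'
    rintro σ (⟨v, rfl⟩ | ⟨v, w, hvw, rfl⟩) τ hτ hne
    · exact Or.inl ⟨v, aux τ v hne⟩
    · by_cases hv : v ∈ τ <;> by_cases hw : w ∈ τ
      · exact Or.inr ⟨v, w, hvw, by
          rw [Set.inter_eq_left]; rintro z (rfl | rfl) <;> assumption⟩
      · exact Or.inl ⟨v, by
          rw [Set.insert_inter_of_mem hv, Set.singleton_inter_of_notMem hw]; simp⟩
      · exact Or.inl ⟨w, by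
          rw [Set.insert_inter_of_notMem hv, Set.singleton_inter_of_mem hw]⟩
      · exfalso
        obtain ⟨z, rfl | rfl, hz⟩ := hne
        · exact hv hz
        · exact hw hz

/-- The Cartesian product of finitely many cube complexes; its cubes are the products of cubes. -/
def pi {n : ℕ} {W : Fin n → Type u} (Y : ∀ i, CubeComplex (W i)) : CubeComplex (∀ i, W i) where
  cubes := {σ | ∃ s : ∀ i, Set (W i), (∀ i, s i ∈ (Y i).cubes) ∧ σ = Set.univ.pi s}
  singleton_mem v := ⟨fun i => {v i}, fun i => (Y i).singleton_mem _, (Set.univ_pi_singleton v).symm⟩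
  exists_chart := by
    rintro σ ⟨s, hs, rfl⟩
    choose d φ hφ hr using fun i => (Y i).exists_chart (s i) (hs i)
    let e : (Σ i, Fin (d i)) ≃ Fin (∑ i, d i) := finSigmaFinEquiv
    let r : (Fin (∑ i, d i) → Bool) → ∀ i, Fin (d i) → Bool := fun b i k => b (e ⟨i, k⟩)
    have hrange : Set.range (fun b i => φ i (r b i)) = Set.univ.pi s := by
      ext x
      simp only [Set.mem_range, Set.mem_univ_pi]
      constructor
      · rintro ⟨b, rfl⟩ i
        rw [← hr i]
        exact ⟨_, rfl⟩
      · intro hx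
        have hx' : ∀ i, ∃ b, φ i b = x i := fun i => by
          have := hx i
          rwa [← hr i] at this
        choose b hb using hx'
        refine ⟨fun m => b (e.symm m).1 (e.symm m).2, ?_⟩
        funext i
        rw [← hb i]
        congr 1
        funext k
        change b (e.symm (e ⟨i, k⟩)).1 (e.symm (e ⟨i, k⟩)).2 = b i k
        rw [e.symm_apply_apply]
    refine ⟨∑ i, d i, fun b i => φ i (r b i), ⟨?_, fun τ hτ => ?_⟩, hrange⟩
    · intro a b hab
      funext m
      have h1 := (hφ (e.symm m).1).1 (congrFun hab (e.symm m).1)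
      have h2 := congrFun h1 (e.symm m).2
      simpa [r] using h2
    · rw [hrange] at hτ
      constructor
      · rintro ⟨t, ht, rfl⟩
        have hne : ∀ i, (t i).Nonempty := fun i => by
          obtain ⟨d', ψ, -, h⟩ := (Y i).exists_chart _ (ht i)
          rw [← h]
          exact Set.range_nonempty ψ
        have hts : ∀ i, t i ⊆ s i := by
          intro i
          rcases Set.univ_pi_subset_univ_pi_iff.1 hτ with h | ⟨j, hj⟩
          · exact h i
          · exact absurd hj (hne j).ne_empty
        choose S c hSc using fun i =>
          ((hφ i).2 (t i) (by rw [hr i]; exact hts i)).1 (ht i)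
        refine ⟨{m | (e.symm m).2 ∈ S (e.symm m).1}, fun m => c (e.symm m).1 (e.symm m).2, ?_⟩
        ext b
        have h1 : (b ∈ (fun b i => φ i (r b i)) ⁻¹' Set.univ.pi t) ↔
            ∀ i, r b i ∈ φ i ⁻¹' t i := by
          simp
        rw [h1]
        constructor
        · intro h m hm
          have h2 := h (e.symm m).1
          rw [hSc] at h2
          simpa [r] using h2 _ hm
        · intro h i
          rw [hSc]
          intro k hk
          have h2 := h (e ⟨i, k⟩) (by
            change (e.symm (e ⟨i, k⟩)).2 ∈ S (e.symm (e ⟨i, k⟩)).1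
            rw [e.symm_apply_apply]
            exact hk)
          change b (e ⟨i, k⟩) = c (e.symm (e ⟨i, k⟩)).1 (e.symm (e ⟨i, k⟩)).2 at h2
          rw [e.symm_apply_apply] at h2
          exact h2
      · rintro ⟨S, c, hSc⟩
        refine ⟨fun i => φ i '' {b | ∀ k ∈ {k | e ⟨i, k⟩ ∈ S}, b k = c (e ⟨i, k⟩)}, fun i => ?_, ?_⟩
        · refine ((hφ i).2 _ (Set.image_subset_range _ _)).2 ⟨{k | e ⟨i, k⟩ ∈ S}, fun k => c (e ⟨i, k⟩), ?_⟩
          exact Set.preimage_image_eq _ (hφ i).1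
        · have hmem : ∀ b, (fun i => φ i (r b i)) ∈ τ ↔ ∀ m ∈ S, b m = c m :=
            fun b => Set.ext_iff.1 hSc b
          ext x
          simp only [Set.mem_univ_pi]
          constructor
          · intro hx
            have hx' := hτ hx
            rw [← hrange] at hx'
            obtain ⟨b, rfl⟩ := hx'
            intro i
            exact ⟨_, fun k hk => (hmem b).1 hx _ hk, rfl⟩
          · intro hx
            choose b hb hbx using hx
            have : x = fun i => φ i (r (fun m => b (e.symm m).1 (e.symm m).2) i) := by
              funext i
              rw [← hbx i]
              congr 1
              funext k
              change b i k = b (e.symm (e ⟨i, k⟩)).1 (e.symm (e ⟨i, k⟩)).2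
              rw [e.symm_apply_apply]
            rw [this]
            refine (hmem fun m => b (e.symm m).1 (e.symm m).2).2 ?_
            intro m hm
            have := hb (e.symm m).1 (e.symm m).2 (by simpa using hm)
            simpa using this
  inter_mem := by
    rintro σ ⟨s, hs, rfl⟩ τ ⟨t, ht, rfl⟩ hne
    rw [← Set.pi_inter_distrib] at hne ⊢
    refine ⟨_, fun i => (Y i).inter_mem _ (hs i) _ (ht i) ?_, rfl⟩
    exact Set.univ_pi_nonempty_iff.1 hne i

/-- `X` isometrically embeds in a Cartesian product of at most `k` trees. -/
def EmbedsInTrees {V : Type u} (X : CubeComplex V) (k : ℕ) : Prop :=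
  ∃ n ≤ k, ∃ (W : Fin n → Type u) (T : ∀ i, SimpleGraph (W i)),
    (∀ i, (T i).IsTree) ∧ X.IsometricallyEmbeds (pi fun i => ofGraph (T i))

/-- `τ(X)`: the least number of factors of a product of trees in which `X` isometrically embeds
(`⊤` if there is no finite product of this kind). -/
noncomputable def treeNumber {V : Type u} (X : CubeComplex V) : ℕ∞ :=
  ⨅ (k : ℕ) (_ : X.EmbedsInTrees k), (k : ℕ∞)

end CubeComplex

/-! ## Isometric embeddings of graphs in products of trees -/

/-- The Cartesian product of a family of graphs. -/
def graphProduct {n : ℕ} {W : Fin n → Type u} (G : ∀ i, SimpleGraph (W i)) :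
    SimpleGraph (∀ i, W i) where
  Adj x y := ∃ i, (G i).Adj (x i) (y i) ∧ ∀ j, j ≠ i → x j = y j
  symm := ⟨fun _ _ ⟨i, h, h'⟩ => ⟨i, h.symm, fun j hj => (h' j hj).symm⟩⟩
  loopless := ⟨fun _ ⟨_, h, _⟩ => h.ne rfl⟩

/-- The graph `G` isometrically embeds (for the path metrics) in a Cartesian product of at most
`k` trees. -/
def GraphEmbedsInTrees {V : Type u} (G : SimpleGraph V) (k : ℕ) : Prop :=
  ∃ n ≤ k, ∃ (W : Fin n → Type u) (T : ∀ i, SimpleGraph (W i)),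
    (∀ i, (T i).IsTree) ∧ ∃ f : V → ∀ i, W i,
      ∀ x y, (graphProduct T).edist (f x) (f y) = G.edist x y

/-- `τ(G)`: the least number of factors of a product of trees in which `G` isometrically embeds
(`⊤` if there is no finite product of this kind). -/
noncomputable def graphTreeNumber {V : Type u} (G : SimpleGraph V) : ℕ∞ :=
  ⨅ (k : ℕ) (_ : GraphEmbedsInTrees G k), (k : ℕ∞)

/-! Everything rests on the combinatorics of hyperplanes. Fix a base vertex `o` and let `sep o v` be
the set of hyperplanes crossed by a geodesic from `v` to `o`. The map `v ↦ sep o v` embeds the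
1-skeleton isometrically in a hypercube: an edge changes exactly one membership, that of its own
hyperplane, and the distance of two vertices is the number of hyperplanes that separate them.

The source of these facts is a uniqueness theorem: in a CAT(0) cube complex any two reduced edge
paths with the same endpoints differ by pushes across 2-cubes only (`IsCAT0.squareEquiv`). Flag
links enter through 3-cubes: three squares around a vertex bound a cube, and this controls how two
square equivalent paths can begin (`SquareEquiv.start`). Hence prepending an edge, with
cancellation, is a well-defined operation on classes of reduced paths; it respects backtracks and
squares, so the reduction of a path depends on its homotopy class alone. By simple connectivity
there is one class for given endpoints. It follows that the 1-skeleton is bipartite, satisfies the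
quadrangle condition, and that no geodesic crosses a hyperplane twice.

From trees to colours (`IsCAT0.colorable_of_map`): an edge of `X` moves in one factor only. A tree
has no 4-cycle, so opposite sides of a square move in the same factor and adjacent sides in
different ones. Thus each hyperplane has a factor, its colour, and since crossing hyperplanes cross
in a 2-cube (`IsCAT0.exists_square_of_crosses`) the colouring is proper.

From colours to trees: restrict the sets `sep o v` to the hyperplanes of one colour. These do not
cross one another, so the restricted sets, adjacent when they differ in one element, form a tree
(`IsCAT0.colourTree_isTree`). A vertex of the product of the trees is labelled by the union of its
components, and the image of `v` has the label `sep o v`, so no distance is lost.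

For the `ℓ¹`-metric the labels become real coordinates in `[0,1]`, one for each hyperplane. A chain
is at least as long as the total change of the coordinates (`IsLabelling.sum_abs_le`), both in `X`
and in the product of trees; in `X` this bound is attained (`IsCAT0.exists_chain`) by moving one
coordinate at a time. The map to the product preserves coordinates and does not lengthen chains,
hence is an isometry. -/

namespace CubeComplex

/-! ## Combinatorics of cubes -/

/-- The vertex of the standard cube obtained by changing the coordinate `i`. -/
def flipAt {d : ℕ} (i : Fin d) (b : Fin d → Bool) : Fin d → Bool := Function.update b i (!b i)

@[simp] theorem flipAt_self {d : ℕ} (i : Fin d) (b : Fin d → Bool) : flipAt i b i = !b i := by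
  simp [flipAt]

theorem flipAt_of_ne {d : ℕ} {i j : Fin d} (h : j ≠ i) (b : Fin d → Bool) :
    flipAt i b j = b j := by
  simp [flipAt, h]

@[simp] theorem flipAt_flipAt {d : ℕ} (i : Fin d) (b : Fin d → Bool) :
    flipAt i (flipAt i b) = b := by
  funext j
  by_cases h : j = i
  · subst h; simp
  · simp [flipAt_of_ne h]

theorem flipAt_comm {d : ℕ} (i j : Fin d) (b : Fin d → Bool) :
    flipAt i (flipAt j b) = flipAt j (flipAt i b) := by
  by_cases hij : i = j
  · subst hij; rfl
  funext k
  by_cases h : k = i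
  · subst h; simp [flipAt_of_ne hij]
  · by_cases h' : k = j
    · subst h'; simp [flipAt_of_ne h]
    · simp [flipAt_of_ne h, flipAt_of_ne h']

theorem flipAt_ne {d : ℕ} (i : Fin d) (b : Fin d → Bool) : flipAt i b ≠ b := fun h => by
  have := congrFun h i
  simp at this

theorem flipAt_injective {d : ℕ} (b : Fin d → Bool) {i j : Fin d} (h : flipAt i b = flipAt j b) :
    i = j := by
  by_contra hij
  have := congrFun h i
  simp [flipAt_of_ne hij] at this

theorem flipAt_flipAt_ne {d : ℕ} {i j : Fin d} (h : i ≠ j) (b : Fin d → Bool) :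
    flipAt i (flipAt j b) ≠ b := fun hb => by
  have := congrFun hb i
  simp [flipAt_of_ne h] at this

/-- A property of vertices that does not change when a coordinate outside `T` changes depends
on the coordinates in `T` only. -/
theorem iff_of_flipAt_iff {d : ℕ} (T : Set (Fin d)) (Q : (Fin d → Bool) → Prop)
    (h : ∀ b, ∀ j ∉ T, (Q (flipAt j b) ↔ Q b)) (b b' : Fin d → Bool) (hb : ∀ j ∈ T, b j = b' j) :
    Q b ↔ Q b' := by
  obtain ⟨n, hn⟩ : ∃ n, (Finset.univ.filter fun j => b j ≠ b' j).card = n := ⟨_, rfl⟩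
  induction n generalizing b with
  | zero =>
    have : b = b' := by
      funext j
      by_contra hj
      rw [Finset.card_eq_zero] at hn
      have : j ∈ (Finset.univ.filter fun j => b j ≠ b' j) := by simp [hj]
      rw [hn] at this
      simp at this
    rw [this]
  | succ n ih =>
    obtain ⟨j, hj⟩ : (Finset.univ.filter fun j => b j ≠ b' j).Nonempty := by
      rw [← Finset.card_pos]; omega
    have hjb : b j ≠ b' j := by simpa using hj
    have hjT : j ∉ T := fun hT => hjb (hb j hT)
    rw [← h b j hjT]
    refine ih _ (fun k hk => ?_) ?_
    · rw [flipAt_of_ne (by rintro rfl; exact hjT hk)]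
      exact hb k hk
    · have : (Finset.univ.filter fun k => flipAt j b k ≠ b' k) =
          (Finset.univ.filter fun k => b k ≠ b' k).erase j := by
        ext k
        by_cases hk : k = j
        · subst hk
          simp only [flipAt_self, Finset.mem_filter, Finset.mem_univ, true_and, Finset.mem_erase,
            ne_eq, not_true_eq_false, false_and, iff_false, not_not]
          revert hjb
          cases b k <;> cases b' k <;> simp
        · simp [flipAt_of_ne hk, hk]
      rw [this, Finset.card_erase_of_mem hj, hn]
      rfl

variable {V : Type u} {X : CubeComplex V}

theorem IsChart.adj {d : ℕ} {φ : (Fin d → Bool) → V} (hφ : X.IsChart φ) (b : Fin d → Bool)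
    (i : Fin d) : X.oneSkeleton.Adj (φ b) (φ (flipAt i b)) := by
  refine ⟨fun h => flipAt_ne i b (hφ.1 h).symm, ?_⟩
  refine (hφ.2 _ ?_).2 ⟨{i}ᶜ, b, ?_⟩
  · rintro _ (rfl | rfl) <;> exact ⟨_, rfl⟩
  · ext b'
    simp only [Set.mem_preimage, Set.mem_insert_iff, Set.mem_singleton_iff, hφ.1.eq_iff,
      Set.mem_compl_iff, Set.mem_ofPred_eq]
    constructor
    · rintro (rfl | rfl) j hj
      · rfl
      · exact flipAt_of_ne hj b
    · intro h
      by_cases hi : b' i = b i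
      · left
        funext j
        by_cases hj : j = i
        · rw [hj, hi]
        · exact h j hj
      · right
        funext j
        by_cases hj : j = i
        · subst hj
          rw [flipAt_self]
          revert hi
          cases b' j <;> cases b j <;> simp
        · rw [flipAt_of_ne hj]
          exact h j hj

theorem IsChart.eq_flipAt {d : ℕ} {φ : (Fin d → Bool) → V} (hφ : X.IsChart φ)
    {b b' : Fin d → Bool} (h : X.oneSkeleton.Adj (φ b) (φ b')) : ∃ i, b' = flipAt i b := by
  obtain ⟨S, c, hS⟩ := (hφ.2 {φ b, φ b'} (by rintro _ (rfl | rfl) <;> exact ⟨_, rfl⟩)).1 h.2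
  have hmem : ∀ a, (a = b ∨ a = b') ↔ ∀ i ∈ S, a i = c i := by
    intro a
    have := Set.ext_iff.1 hS a
    simpa [hφ.1.eq_iff] using this
  have hne : b ≠ b' := fun hb => h.1 (by rw [hb])
  obtain ⟨i, hi⟩ := Function.ne_iff.1 hne
  have hb := (hmem b).1 (Or.inl rfl)
  have hb' := (hmem b').1 (Or.inr rfl)
  have hiS : i ∉ S := fun hiS => hi ((hb i hiS).trans (hb' i hiS).symm)
  refine ⟨i, ?_⟩
  rcases (hmem (flipAt i b)).2 (fun j hj => by
    rw [flipAt_of_ne (by rintro rfl; exact hiS hj)]; exact hb j hj) with h1 | h1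
  · exact absurd h1 (flipAt_ne i b)
  · exact h1.symm

theorem IsChart.isTwoCube {d : ℕ} {φ : (Fin d → Bool) → V} (hφ : X.IsChart φ)
    (b : Fin d → Bool) {i j : Fin d} (hij : i ≠ j) :
    X.IsTwoCube (φ b) (φ (flipAt i b)) (φ (flipAt i (flipAt j b))) (φ (flipAt j b)) := by
  refine ⟨fun h => flipAt_flipAt_ne hij b (hφ.1 h).symm,
    fun h => hij (flipAt_injective b (hφ.1 h)), hφ.adj b i, ?_, (hφ.adj _ i).symm,
    (hφ.adj b j).symm, ?_⟩
  · rw [flipAt_comm]; exact hφ.adj _ j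
  refine (hφ.2 _ ?_).2 ⟨{i, j}ᶜ, b, ?_⟩
  · rintro _ (rfl | rfl | rfl | rfl) <;> exact ⟨_, rfl⟩
  ext b'
  simp only [Set.mem_preimage, Set.mem_insert_iff, Set.mem_singleton_iff, hφ.1.eq_iff,
    Set.mem_compl_iff, Set.mem_ofPred_eq, not_or]
  constructor
  · rintro (rfl | rfl | rfl | rfl) k ⟨hk, hk'⟩
    · rfl
    · exact flipAt_of_ne hk b
    · rw [flipAt_of_ne hk, flipAt_of_ne hk']
    · exact flipAt_of_ne hk' b
  · intro h
    have key : ∀ a : Fin d → Bool, (∀ k, k ≠ i → k ≠ j → a k = b k) → b' i = a i → b' j = a j →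
        b' = a := by
      intro a ha hi hj
      funext k
      by_cases hki : k = i
      · rw [hki, hi]
      by_cases hkj : k = j
      · rw [hkj, hj]
      rw [ha k hki hkj, h k ⟨hki, hkj⟩]
    have hb : ∀ k, b' k = b k ∨ b' k = !b k := by
      intro k; cases b' k <;> cases b k <;> simp
    rcases hb i with hi | hi <;> rcases hb j with hj | hj
    · exact Or.inl (key b (fun _ _ _ => rfl) hi hj)
    · refine Or.inr (Or.inr (Or.inr (key _ (fun k _ hk => flipAt_of_ne hk b) ?_ ?_)))
      · rw [flipAt_of_ne hij, hi]
      · rw [flipAt_self, hj]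
    · refine Or.inr (Or.inl (key _ (fun k hk _ => flipAt_of_ne hk b) ?_ ?_))
      · rw [flipAt_self, hi]
      · rw [flipAt_of_ne hij.symm, hj]
    · refine Or.inr (Or.inr (Or.inl (key _ (fun k hk hk' => ?_) ?_ ?_)))
      · rw [flipAt_of_ne hk, flipAt_of_ne hk']
      · rw [flipAt_self, flipAt_of_ne hij, hi]
      · rw [flipAt_of_ne hij.symm, flipAt_self, hj]

theorem IsTwoCube.rotate {a b c d : V} (h : X.IsTwoCube a b c d) : X.IsTwoCube b c d a := by
  obtain ⟨h1, h2, h3, h4, h5, h6, h7⟩ := h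
  refine ⟨h2, h1.symm, h4, h5, h6, h3, ?_⟩
  convert h7 using 1
  ext x; simp only [Set.mem_insert_iff, Set.mem_singleton_iff]; tauto

theorem IsTwoCube.reflect {a b c d : V} (h : X.IsTwoCube a b c d) : X.IsTwoCube a d c b := by
  obtain ⟨h1, h2, h3, h4, h5, h6, h7⟩ := h
  refine ⟨h1, h2.symm, h6.symm, h5.symm, h4.symm, h3.symm, ?_⟩
  convert h7 using 1
  ext x; simp only [Set.mem_insert_iff, Set.mem_singleton_iff]; tauto

theorem ncard_cube {σ : Set V} (hσ : σ ∈ X.cubes) : ∃ d : ℕ, σ.ncard = 2 ^ d := by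
  obtain ⟨d, φ, hφ, rfl⟩ := X.exists_chart σ hσ
  refine ⟨d, ?_⟩
  rw [← Set.image_univ, Set.ncard_image_of_injective _ hφ.1, Set.ncard_univ]
  simp

/-- Otherwise the two squares would meet in exactly the three vertices `a, b, d`, but a cube has `2
^ n` vertices. So a square is determined by one of its corners. -/
theorem IsTwoCube.opposite_unique {a b c c' d : V} (h : X.IsTwoCube a b c d)
    (h' : X.IsTwoCube a b c' d) : c = c' := by
  by_contra hne
  have hi := X.inter_mem _ h.2.2.2.2.2.2 _ h'.2.2.2.2.2.2 ⟨a, by simp, by simp⟩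
  obtain ⟨h1, h2, h3, h4, h5, h6, h7⟩ := h
  have h3' := h3.ne
  have h4' := h4.ne
  have h5' := h5.ne
  have h6' := h6.ne
  have : ({a, b, c, d} : Set V) ∩ {a, b, c', d} = {a, b, d} := by
    ext x
    simp only [Set.mem_inter_iff, Set.mem_insert_iff, Set.mem_singleton_iff]
    constructor
    · rintro ⟨rfl | rfl | rfl | rfl, h8⟩ <;> tauto
    · tauto
  rw [this] at hi
  obtain ⟨n, hn⟩ := ncard_cube hi
  have h3 : ({a, b, d} : Set V).ncard = 3 := by
    rw [Set.ncard_eq_three]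
    exact ⟨a, b, d, h3', h6'.symm, h2, rfl⟩
  rw [h3] at hn
  rcases n with _ | _ | n
  · simp at hn
  · simp at hn
  · rw [pow_succ] at hn; omega

theorem IsTwoCube.not_adj {a b c d : V} (h : X.IsTwoCube a b c d) : ¬ X.oneSkeleton.Adj a c := by
  intro hac
  obtain ⟨h1, h2, h3, h4, h5, h6, h7⟩ := h
  obtain ⟨n, φ, hφ, hr⟩ := X.exists_chart _ h7
  replace hφ : X.IsChart φ := hφ
  obtain ⟨x, rfl⟩ : a ∈ Set.range φ := by rw [hr]; simp
  obtain ⟨y, rfl⟩ : b ∈ Set.range φ := by rw [hr]; simp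
  obtain ⟨z, rfl⟩ : c ∈ Set.range φ := by rw [hr]; simp
  obtain ⟨i, rfl⟩ := hφ.eq_flipAt h3
  obtain ⟨j, rfl⟩ := hφ.eq_flipAt h4
  obtain ⟨k, hk⟩ := hφ.eq_flipAt hac
  have hij : j ≠ i := fun hij => h1 (by rw [hij]; simp)
  have e1 := congrFun hk j
  have e2 := congrFun hk i
  rw [flipAt_self, flipAt_of_ne hij] at e1
  rw [flipAt_of_ne hij.symm, flipAt_self] at e2
  by_cases hjk : j = k
  · subst hjk
    rw [flipAt_of_ne hij.symm] at e2
    simp at e2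
  · rw [flipAt_of_ne hjk] at e1
    simp at e1

theorem IsTwoCube.mem_link {x y c z : V} (h : X.IsTwoCube x y c z) :
    ({y, z} : Set V) ∈ X.link x := by
  refine ⟨_, h.2.2.2.2.2.2, by simp, ?_⟩
  ext w
  simp only [Set.mem_insert_iff, Set.mem_singleton_iff, Set.mem_ofPred_eq]
  constructor
  · rintro (rfl | rfl)
    · exact ⟨by simp, h.2.2.1⟩
    · exact ⟨by simp, h.2.2.2.2.2.1.symm⟩
  · rintro ⟨rfl | rfl | rfl | rfl, hw⟩
    · exact absurd rfl hw.ne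
    · simp
    · exact absurd hw h.not_adj
    · simp

theorem mem_link_of_adj {x y : V} (h : X.oneSkeleton.Adj x y) : ({y} : Set V) ∈ X.link x := by
  refine ⟨_, h.2, by simp, ?_⟩
  ext w
  simp only [Set.mem_insert_iff, Set.mem_singleton_iff, Set.mem_ofPred_eq]
  constructor
  · rintro rfl
    exact ⟨by simp, h⟩
  · rintro ⟨rfl | rfl, hw⟩
    · exact absurd rfl hw.ne
    · rfl

/-- In a complex with flag links, neighbours of `v` any two of which lie in a common square
with `v` are the neighbours of `v` in a cube. -/
theorem HasFlagLinks.exists_chart (hX : X.HasFlagLinks) (v : V) (s : Finset V)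
    (hs : ∀ y ∈ s, X.oneSkeleton.Adj v y)
    (hs' : ∀ y ∈ s, ∀ z ∈ s, y ≠ z → ∃ c, X.IsTwoCube v y c z) :
    ∃ (d : ℕ) (φ : (Fin d → Bool) → V) (b : Fin d → Bool), X.IsChart φ ∧ φ b = v ∧
      (∀ i, φ (flipAt i b) ∈ s) ∧ ∀ y ∈ s, ∃ i, φ (flipAt i b) = y := by
  obtain ⟨σ, hσ, hv, hsσ⟩ := hX v s (fun y hy z hz => by
    by_cases hyz : y = z
    · subst hyz
      rw [Set.pair_eq_singleton]
      exact mem_link_of_adj (hs y hy)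
    · exact (hs' y hy z hz hyz).choose_spec.mem_link)
  obtain ⟨d, φ, hφ, rfl⟩ := X.exists_chart σ hσ
  obtain ⟨b, rfl⟩ := hv
  replace hφ : X.IsChart φ := hφ
  refine ⟨d, φ, b, hφ, rfl, fun i => ?_, fun y hy => ?_⟩
  · rw [← Finset.mem_coe, hsσ]
    exact ⟨⟨_, rfl⟩, hφ.adj b i⟩
  · rw [← Finset.mem_coe, hsσ] at hy
    obtain ⟨⟨b', rfl⟩, hy⟩ := hy
    obtain ⟨i, rfl⟩ := hφ.eq_flipAt hy
    exact ⟨i, rfl⟩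

/-- Three squares around a vertex are part of the boundary of a 3-cube. -/
theorem HasFlagLinks.exists_opposite (hX : X.HasFlagLinks) {w x y z p q r : V}
    (h1 : X.IsTwoCube w x p y) (h2 : X.IsTwoCube w y q z) (h3 : X.IsTwoCube w x r z) :
    ∃ g, X.IsTwoCube x p g r ∧ X.IsTwoCube p y q g ∧ X.IsTwoCube r z q g := by
  classical
  obtain ⟨d, φ, b, hφ, rfl, -, hs⟩ := hX.exists_chart w {x, y, z} (by
    simp only [Finset.mem_insert, Finset.mem_singleton]
    rintro v (rfl | rfl | rfl)
    · exact h1.2.2.1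
    · exact h2.2.2.1
    · exact h3.reflect.2.2.1) (by
    simp only [Finset.mem_insert, Finset.mem_singleton]
    rintro v (rfl | rfl | rfl) v' (rfl | rfl | rfl) hne
    · exact absurd rfl hne
    · exact ⟨_, h1⟩
    · exact ⟨_, h3⟩
    · exact ⟨_, h1.reflect⟩
    · exact absurd rfl hne
    · exact ⟨_, h2⟩
    · exact ⟨_, h3.reflect⟩
    · exact ⟨_, h2.reflect⟩
    · exact absurd rfl hne)
  obtain ⟨i, rfl⟩ := hs x (by simp)
  obtain ⟨j, rfl⟩ := hs y (by simp)
  obtain ⟨k, rfl⟩ := hs z (by simp)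
  have hij : i ≠ j := fun h => h1.2.1 (by rw [h])
  have hjk : j ≠ k := fun h => h2.2.1 (by rw [h])
  have hik : i ≠ k := fun h => h3.2.1 (by rw [h])
  -- The given squares share a corner with squares of the cube found by flagness, so they are those
  -- squares.
  obtain rfl := h1.opposite_unique (hφ.isTwoCube b hij)
  obtain rfl := h2.opposite_unique (hφ.isTwoCube b hjk)
  obtain rfl := h3.opposite_unique (hφ.isTwoCube b hik)
  refine ⟨φ (flipAt i (flipAt j (flipAt k b))), ?_, ?_, ?_⟩
  · have := hφ.isTwoCube (flipAt i b) hjk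
    rw [flipAt_comm j i, flipAt_comm k i, flipAt_comm j i] at this
    exact this
  · have := (hφ.isTwoCube (flipAt j b) hik).rotate.reflect
    rw [flipAt_comm k j] at this
    exact this
  · exact (hφ.isTwoCube (flipAt k b) hij).rotate.reflect

/-! ## Reduced edge paths -/

open SimpleGraph (Walk)

/-- Edge paths that differ by pushing across 2-cubes (without removal of backtracks). -/
inductive SquareEquiv : ∀ {x y : V}, X.oneSkeleton.Walk x y → X.oneSkeleton.Walk x y → Prop
  | refl {x y : V} (p : X.oneSkeleton.Walk x y) : SquareEquiv p p
  | symm {x y : V} {p q : X.oneSkeleton.Walk x y} : SquareEquiv p q → SquareEquiv q p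
  | trans {x y : V} {p q r : X.oneSkeleton.Walk x y} :
      SquareEquiv p q → SquareEquiv q r → SquareEquiv p r
  | cons {x y z : V} (h : X.oneSkeleton.Adj x y) {p q : X.oneSkeleton.Walk y z} :
      SquareEquiv p q → SquareEquiv (Walk.cons h p) (Walk.cons h q)
  | square {a b c d z : V} (hab : X.oneSkeleton.Adj a b) (hbc : X.oneSkeleton.Adj b c)
      (had : X.oneSkeleton.Adj a d) (hdc : X.oneSkeleton.Adj d c)
      (p : X.oneSkeleton.Walk c z) : X.IsTwoCube a b c d →
      SquareEquiv (Walk.cons hab (Walk.cons hbc p)) (Walk.cons had (Walk.cons hdc p))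

theorem SquareEquiv.length_eq {x y : V} {p q : X.oneSkeleton.Walk x y} (h : SquareEquiv p q) :
    p.length = q.length := by
  induction h with
  | refl p => rfl
  | symm _ ih => exact ih.symm
  | trans _ _ ih ih' => exact ih.trans ih'
  | cons h _ ih => simp [ih]
  | square => simp

/-- How two square equivalent paths can begin. -/
def SquareStart {x v : V} (p q : X.oneSkeleton.Walk x v) : Prop :=
  p = q ∨
  (∃ (z : V) (h : X.oneSkeleton.Adj x z) (p' q' : X.oneSkeleton.Walk z v),
    p = Walk.cons h p' ∧ q = Walk.cons h q' ∧ SquareEquiv p' q') ∨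
  ∃ (z u w : V) (hxz : X.oneSkeleton.Adj x z) (hxw : X.oneSkeleton.Adj x w)
    (hzu : X.oneSkeleton.Adj z u) (hwu : X.oneSkeleton.Adj w u)
    (p' : X.oneSkeleton.Walk z v) (q' : X.oneSkeleton.Walk w v) (r : X.oneSkeleton.Walk u v),
    X.IsTwoCube x z u w ∧ p = Walk.cons hxz p' ∧ q = Walk.cons hxw q' ∧
    SquareEquiv p' (Walk.cons hzu r) ∧ SquareEquiv q' (Walk.cons hwu r)

theorem cons_eq_cons {x z w v : V} {h : X.oneSkeleton.Adj x z} {h' : X.oneSkeleton.Adj x w}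
    {p : X.oneSkeleton.Walk z v} {q : X.oneSkeleton.Walk w v}
    (e : Walk.cons h p = Walk.cons h' q) : ∃ hzw : z = w, hzw ▸ p = q := by
  rw [Walk.cons.injEq] at e
  obtain ⟨rfl, e⟩ := e
  exact ⟨rfl, eq_of_heq e⟩

theorem SquareStart.symm {x v : V} {p q : X.oneSkeleton.Walk x v} (h : SquareStart p q) :
    SquareStart q p := by
  rcases h with rfl | ⟨z, h, p', q', rfl, rfl, e⟩ |
    ⟨z, u, w, hxz, hxw, hzu, hwu, p', q', r, hs, rfl, rfl, e1, e2⟩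
  · exact Or.inl rfl
  · exact Or.inr (Or.inl ⟨z, h, q', p', rfl, rfl, e.symm⟩)
  · exact Or.inr (Or.inr ⟨w, u, z, hxw, hxz, hwu, hzu, q', p', r, hs.reflect, rfl, rfl, e2, e1⟩)

/-- The essential case is that of two successive squares, `x z u w` and `x w u' t`. The two
continuations of `q` from `w`, through `u` and through `u'`, are equivalent and shorter than `q`, so
`ih` applies to them. Either `u = u'`, and then `z = t`; or there is a square at `w` containing `u`
and `u'`, and the three squares at `w` lie in a 3-cube, whose vertex `g` opposite to `w` gives the
square `x z g t`. -/
theorem SquareStart.trans (hX : X.HasFlagLinks) {x v : V} {p q s : X.oneSkeleton.Walk x v}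
    (ih : ∀ (y : V) (a b : X.oneSkeleton.Walk y v), a.length < q.length → SquareEquiv a b →
      SquareStart a b)
    (h : SquareStart p q) (h' : SquareStart q s) : SquareStart p s := by
  rcases h with rfl | ⟨z, h, p', q', rfl, rfl, e⟩ |
    ⟨z, u, w, hxz, hxw, hzu, hwu, p', q', r, hs, rfl, rfl, e1, e2⟩
  · exact h'
  · rcases h' with rfl | ⟨z', h', q'', s', e3, rfl, e'⟩ |
      ⟨z', u, w, hxz, hxw, hzu, hwu, q'', s', r, hs, e3, rfl, e1, e2⟩
    · exact Or.inr (Or.inl ⟨_, _, _, _, rfl, rfl, e⟩)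
    · obtain ⟨rfl, rfl⟩ := cons_eq_cons e3
      exact Or.inr (Or.inl ⟨_, _, _, _, rfl, rfl, e.trans e'⟩)
    · obtain ⟨rfl, rfl⟩ := cons_eq_cons e3
      exact Or.inr (Or.inr ⟨_, _, _, _, _, hzu, hwu, _, _, r, hs, rfl, rfl, e.trans e1, e2⟩)
  · rcases h' with rfl | ⟨w', h', q'', s', e3, rfl, e'⟩ |
      ⟨w', u', t, hxw', hxt, hwu', htu', q'', s', r', hs', e3, rfl, e1', e2'⟩
    · exact Or.inr (Or.inr ⟨_, _, _, _, _, hzu, hwu, _, _, r, hs, rfl, rfl, e1, e2⟩)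
    · obtain ⟨rfl, rfl⟩ := cons_eq_cons e3
      exact Or.inr (Or.inr ⟨_, _, _, _, _, hzu, hwu, _, _, r, hs, rfl, rfl, e1, e'.symm.trans e2⟩)
    · obtain ⟨rfl, rfl⟩ := cons_eq_cons e3
      have e : SquareEquiv (Walk.cons hwu r) (Walk.cons hwu' r') := e2.symm.trans e1'
      have key := ih _ _ _ (by rw [← e2.length_eq]; simp) e
      have same : ∀ (huu : u = u'), SquareEquiv (huu ▸ r) r' →
          SquareStart (Walk.cons hxz p') (Walk.cons hxt s') := by
        rintro rfl hr
        have hzt : z = t := hs.rotate.rotate.rotate.opposite_unique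
          hs'.reflect.rotate.rotate.rotate
        subst hzt
        exact Or.inr (Or.inl ⟨_, _, _, _, rfl, rfl,
          (e1.trans (SquareEquiv.cons _ hr)).trans e2'.symm⟩)
      rcases key with h4 | ⟨u₁, h5, r1, r1', h6, h7, hr⟩ |
        ⟨u₁, m, u₂, hwu₁, hwu₂, hum, hum', r1, r2, k, hm, h6, h7, hk, hk'⟩
      · obtain ⟨rfl, rfl⟩ := cons_eq_cons h4
        exact same rfl (SquareEquiv.refl _)
      · obtain ⟨rfl, rfl⟩ := cons_eq_cons h6
        obtain ⟨rfl, rfl⟩ := cons_eq_cons h7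
        exact same rfl hr
      · obtain ⟨rfl, rfl⟩ := cons_eq_cons h6
        obtain ⟨rfl, rfl⟩ := cons_eq_cons h7
        obtain ⟨g, hg1, hg2, hg3⟩ := hX.exists_opposite hs.rotate.rotate.rotate hm
          hs'.reflect.rotate.rotate.rotate
        have hgm := hg2.2.2.2.2.1.symm
        refine Or.inr (Or.inr ⟨_, g, _, hxz, hxt, hg1.2.2.2.1, hg1.2.2.2.2.1.symm, _, _,
          Walk.cons hgm k, hg1, rfl, rfl, ?_, ?_⟩)
        · exact e1.trans ((SquareEquiv.cons _ hk).trans (.square _ _ _ _ _ hg2))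
        · exact e2'.trans ((SquareEquiv.cons _ hk').trans (.square _ _ _ _ _ hg3))

/-- Strong induction on the length, which square equivalence preserves; the shorter paths are needed
for transitivity. Each remaining constructor has one of the three forms by itself or, for `symm`,
inherits it. -/
theorem SquareEquiv.start (hX : X.HasFlagLinks) {v : V} : ∀ (n : ℕ) {x : V}
    {p q : X.oneSkeleton.Walk x v}, p.length = n → SquareEquiv p q → SquareStart p q := by
  intro n
  induction n using Nat.strong_induction_on with
  | _ n ih =>
  intro x p q hn h
  induction h with
  | refl p => exact Or.inl rfl
  | symm h ih' => exact (ih' ih (h.length_eq.trans hn)).symm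
  | trans h h' ih1 ih2 =>
    have hl := h.length_eq.symm.trans hn
    refine SquareStart.trans hX (fun y a b hab => ih a.length (by omega) rfl) (ih1 ih hn) (ih2 ih hl)
  | cons h h' _ => exact Or.inr (Or.inl ⟨_, _, _, _, rfl, rfl, h'⟩)
  | square hab hbc had hdc p hs =>
    exact Or.inr (Or.inr ⟨_, _, _, _, _, hbc, hdc, _, _, p, hs, rfl, rfl, .refl _, .refl _⟩)

/-- Two paths with the same first edge cannot begin on two sides of a square, whose vertices `z` and
`w` would be distinct. -/
theorem SquareEquiv.cons_cancel (hX : X.HasFlagLinks) {x z v : V} {h h' : X.oneSkeleton.Adj x z}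
    {p q : X.oneSkeleton.Walk z v} (e : SquareEquiv (Walk.cons h p) (Walk.cons h' q)) :
    SquareEquiv p q := by
  rcases SquareEquiv.start hX _ rfl e with e | ⟨z', h1, p', q', h2, h3, e'⟩ |
    ⟨z', u, w, hxz, hxw, hzu, hwu, p', q', r, hs, h2, h3, e1, e2⟩
  · obtain ⟨_, rfl⟩ := cons_eq_cons e
    exact .refl _
  · obtain ⟨rfl, rfl⟩ := cons_eq_cons h2
    obtain ⟨_, rfl⟩ := cons_eq_cons h3
    exact e'
  · obtain ⟨rfl, rfl⟩ := cons_eq_cons h2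
    obtain ⟨h4, _⟩ := cons_eq_cons h3
    exact absurd h4 hs.2.1

/-- The quadrangle property of square equivalent paths. -/
theorem SquareEquiv.exists_square (hX : X.HasFlagLinks) {x z w v : V} (hzw : z ≠ w)
    {h : X.oneSkeleton.Adj x z} {h' : X.oneSkeleton.Adj x w}
    {p : X.oneSkeleton.Walk z v} {q : X.oneSkeleton.Walk w v}
    (e : SquareEquiv (Walk.cons h p) (Walk.cons h' q)) :
    ∃ (u : V) (hs : X.IsTwoCube x z u w) (r : X.oneSkeleton.Walk u v),
      SquareEquiv p (Walk.cons hs.2.2.2.1 r) ∧ SquareEquiv q (Walk.cons hs.2.2.2.2.1.symm r) := by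
  rcases SquareEquiv.start hX _ rfl e with e | ⟨z', h1, p', q', h2, h3, e'⟩ |
    ⟨z', u, w, hxz, hxw, hzu, hwu, p', q', r, hs, h2, h3, e1, e2⟩
  · exact absurd (cons_eq_cons e).1 hzw
  · obtain ⟨rfl, rfl⟩ := cons_eq_cons h2
    obtain ⟨h4, _⟩ := cons_eq_cons h3
    exact absurd h4.symm hzw
  · obtain ⟨rfl, rfl⟩ := cons_eq_cons h2
    obtain ⟨rfl, rfl⟩ := cons_eq_cons h3
    exact ⟨u, hs, r, e1, e2⟩

/-- A path is reduced if pushing it across 2-cubes does not create backtracks. -/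
def IsReduced : ∀ {x y : V}, X.oneSkeleton.Walk x y → Prop
  | _, _, .nil => True
  | _, y, .cons (v := z) h p =>
    IsReduced p ∧ ∀ s : X.oneSkeleton.Walk _ y, ¬ SquareEquiv p (Walk.cons (u := z) h.symm s)

/-- Only a change of the first edge, across a square `x z u w`, needs an argument: a backtrack of
the new path can be carried over the square to a backtrack of the old one. -/
theorem SquareEquiv.isReduced (hX : X.HasFlagLinks) {x v : V} {p q : X.oneSkeleton.Walk x v}
    (e : SquareEquiv p q) (hp : IsReduced p) : IsReduced q := by
  obtain ⟨n, hn⟩ : ∃ n, p.length = n := ⟨_, rfl⟩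
  induction n using Nat.strong_induction_on generalizing x with
  | _ n ih =>
  rcases SquareEquiv.start hX _ rfl e with rfl | ⟨z, h, p, q, rfl, rfl, e'⟩ |
    ⟨z, u, w, hxz, hxw, hzu, hwu, p, q, r, hs, rfl, rfl, e1, e2⟩
  · exact hp
  · rw [Walk.length_cons] at hn
    exact ⟨ih p.length (by omega) e' hp.1 rfl, fun s hs => hp.2 s (e'.trans hs)⟩
  · rw [Walk.length_cons] at hn
    have hzr := ih p.length (by omega) e1 hp.1 rfl
    have hlen := e1.length_eq
    rw [Walk.length_cons] at hlen
    have hw : IsReduced (Walk.cons hwu r) := by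
      -- A backtrack `w u w` would turn `z u w` into `z x w`, and the original path would begin with
      -- `x z x`.
      refine ⟨hzr.1, fun s hs' => hp.2 (Walk.cons hxw s) ?_⟩
      refine e1.trans ((SquareEquiv.cons _ hs').trans ?_)
      exact .square _ _ _ _ _ hs.rotate
    refine ⟨ih (r.length + 1) (by omega) e2.symm hw (by simp), fun s hs' => ?_⟩
    -- If `q` could return to `x`, the quadrangle property at `w` would give the square `w u z x`,
    -- and then `r` could start with `u z`: a backtrack in the reduced path `z u r`.
    have e3 := e2.symm.trans hs'
    obtain ⟨m, hm, r', h1, h2⟩ := e3.exists_square hX hs.1.symm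
    obtain rfl : z = m := hs.rotate.rotate.rotate.reflect.opposite_unique hm
    exact hzr.2 _ h1

open Classical in
/-- Prepending an edge to a reduced path, with cancellation if possible. -/
noncomputable def prepend {x z v : V} (h : X.oneSkeleton.Adj x z) (p : X.oneSkeleton.Walk z v) :
    X.oneSkeleton.Walk x v :=
  if hs : ∃ s, SquareEquiv p (Walk.cons h.symm s) then hs.choose else Walk.cons h p

/-- By `cons_cancel` the remainder chosen in `prepend` is unique up to square equivalence. -/
theorem prepend_of_equiv (hX : X.HasFlagLinks) {x z v : V} {h : X.oneSkeleton.Adj x z}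
    {p : X.oneSkeleton.Walk z v} {s : X.oneSkeleton.Walk x v}
    (hs : SquareEquiv p (Walk.cons h.symm s)) : SquareEquiv (prepend h p) s := by
  have h' : ∃ s, SquareEquiv p (Walk.cons h.symm s) := ⟨s, hs⟩
  rw [prepend, dif_pos h']
  exact (h'.choose_spec.symm.trans hs).cons_cancel hX

theorem prepend_of_not {x z v : V} {h : X.oneSkeleton.Adj x z}
    {p : X.oneSkeleton.Walk z v} (hs : ∀ s, ¬ SquareEquiv p (Walk.cons h.symm s)) :
    prepend h p = Walk.cons h p := by
  rw [prepend, dif_neg (by push Not; exact hs)]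

theorem prepend_congr (hX : X.HasFlagLinks) {x z v : V} (h : X.oneSkeleton.Adj x z)
    {p q : X.oneSkeleton.Walk z v} (e : SquareEquiv p q) :
    SquareEquiv (prepend h p) (prepend h q) := by
  by_cases hs : ∃ s, SquareEquiv p (Walk.cons h.symm s)
  · obtain ⟨s, hs⟩ := hs
    exact (prepend_of_equiv hX hs).trans (prepend_of_equiv hX (e.symm.trans hs)).symm
  · push Not at hs
    rw [prepend_of_not hs, prepend_of_not fun s hs' => hs s (e.trans hs')]
    exact .cons _ e

theorem IsReduced.prepend (hX : X.HasFlagLinks) {x z v : V} (h : X.oneSkeleton.Adj x z)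
    {p : X.oneSkeleton.Walk z v} (hp : IsReduced p) : IsReduced (prepend h p) := by
  by_cases hs : ∃ s, SquareEquiv p (Walk.cons h.symm s)
  · obtain ⟨s, hs⟩ := hs
    exact (prepend_of_equiv hX hs).symm.isReduced hX (hs.isReduced hX hp).1
  · push Not at hs
    rw [prepend_of_not hs]
    exact ⟨hp, hs⟩

/-- If `p` can start with `h`, this edge is removed and then restored, reducedness of `p` preventing
a second cancellation. Otherwise the edge is added and then cancelled. -/
theorem prepend_prepend (hX : X.HasFlagLinks) {x z v : V} (h : X.oneSkeleton.Adj x z)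
    {p : X.oneSkeleton.Walk x v} (hp : IsReduced p) :
    SquareEquiv (prepend h (prepend h.symm p)) p := by
  by_cases hs : ∃ s, SquareEquiv p (Walk.cons h s)
  · obtain ⟨s, hs⟩ := hs
    have h1 := prepend_of_equiv hX (h := h.symm) hs
    refine (prepend_congr hX h h1).trans ?_
    rw [prepend_of_not (hs.isReduced hX hp).2]
    exact hs.symm
  · push Not at hs
    rw [prepend_of_not (h := h.symm) hs]
    exact prepend_of_equiv hX (.refl _)

/-- With `p` equivalent to `c b s`, both sides become `a b s`. On the left `s` cannot start with `b
a`, or else `p` could start with `c b a`, hence with `c d`. On the right `d c b s` is pushed to `d a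
b s` and the edge `a d` cancels. -/
theorem prepend_square_of_cancel (hX : X.HasFlagLinks) {a b c d v : V}
    (hab : X.oneSkeleton.Adj a b) (hbc : X.oneSkeleton.Adj b c) (had : X.oneSkeleton.Adj a d)
    (hdc : X.oneSkeleton.Adj d c) (hs : X.IsTwoCube a b c d) {p : X.oneSkeleton.Walk c v}
    (hb : ∃ s, SquareEquiv p (Walk.cons hbc.symm s))
    (hd : ¬ ∃ s, SquareEquiv p (Walk.cons hdc.symm s)) :
    SquareEquiv (prepend hab (prepend hbc p)) (prepend had (prepend hdc p)) := by
  obtain ⟨s, e⟩ := hb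
  push Not at hd
  have h1 : ∀ r, ¬ SquareEquiv s (Walk.cons hab.symm r) := fun r hr =>
    hd (Walk.cons had.symm r) ((e.trans (.cons _ hr)).trans
      (.square _ _ _ _ _ hs.rotate.rotate.reflect))
  refine (prepend_congr hX hab (prepend_of_equiv hX e)).trans ?_
  rw [prepend_of_not h1, prepend_of_not hd]
  refine (prepend_of_equiv hX ?_).symm
  exact (SquareEquiv.cons _ e).trans (.square _ _ _ _ _ hs.reflect.rotate)

/-- If both first edges cancel, the quadrangle property at `c` yields a common remainder that starts
at `a`. If neither does, the second edges do not cancel either, and the two results differ by the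
square itself. -/
theorem prepend_square (hX : X.HasFlagLinks) {a b c d v : V} (hab : X.oneSkeleton.Adj a b)
    (hbc : X.oneSkeleton.Adj b c) (had : X.oneSkeleton.Adj a d) (hdc : X.oneSkeleton.Adj d c)
    (hs : X.IsTwoCube a b c d) (p : X.oneSkeleton.Walk c v) :
    SquareEquiv (prepend hab (prepend hbc p)) (prepend had (prepend hdc p)) := by
  by_cases hb : ∃ s, SquareEquiv p (Walk.cons hbc.symm s) <;>
    by_cases hd : ∃ s, SquareEquiv p (Walk.cons hdc.symm s)
  · obtain ⟨s, e⟩ := hb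
    obtain ⟨t, e'⟩ := hd
    obtain ⟨u, hu, r, h1, h2⟩ := (e.symm.trans e').exists_square hX hs.2.1
    obtain rfl : a = u := hs.rotate.rotate.reflect.opposite_unique hu
    exact ((prepend_congr hX hab (prepend_of_equiv hX e)).trans (prepend_of_equiv hX h1)).trans
      ((prepend_congr hX had (prepend_of_equiv hX e')).trans (prepend_of_equiv hX h2)).symm
  · exact prepend_square_of_cancel hX hab hbc had hdc hs hb hd
  · exact (prepend_square_of_cancel hX had hdc hab hbc hs.reflect hd hb).symm
  · push Not at hb hd
    have key : ∀ {b d : V} (hab : X.oneSkeleton.Adj a b) (hbc : X.oneSkeleton.Adj b c)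
        (hdc : X.oneSkeleton.Adj d c), X.IsTwoCube a b c d →
        (∀ s, ¬ SquareEquiv p (Walk.cons hdc.symm s)) →
        ∀ s, ¬ SquareEquiv (Walk.cons hbc p) (Walk.cons hab.symm s) := by
      intro b d hab hbc hdc hs hd s e
      obtain ⟨u, hu, r, h1, h2⟩ := e.exists_square hX hs.1.symm
      obtain rfl : d = u := hs.rotate.opposite_unique hu
      exact hd _ h1
    rw [prepend_of_not hb, prepend_of_not hd, prepend_of_not (key hab hbc hdc hs hd),
      prepend_of_not (key had hdc hbc hs.reflect hb)]
    exact .square _ _ _ _ _ hs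

/-- The reduced path obtained by prepending the edges of a path one by one. -/
noncomputable def reduce : ∀ {x y : V}, X.oneSkeleton.Walk x y → X.oneSkeleton.Walk x y
  | _, _, .nil => .nil
  | _, _, .cons h p => prepend h (reduce p)

theorem isReduced_reduce (hX : X.HasFlagLinks) {x y : V} (p : X.oneSkeleton.Walk x y) :
    IsReduced (reduce p) := by
  induction p with
  | nil => trivial
  | cons h p ih => exact ih.prepend hX h

theorem IsReduced.reduce_equiv {x y : V} {p : X.oneSkeleton.Walk x y}
    (hX : X.HasFlagLinks) (hp : IsReduced p) : SquareEquiv (reduce p) p := by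
  induction p with
  | nil => exact .refl _
  | cons h p ih =>
    refine (prepend_congr hX h (ih hp.1)).trans ?_
    rw [prepend_of_not hp.2]
    exact .refl _

/-- Van der Waerden's trick: edges act on the classes of reduced paths, and this action satisfies
the relations that generate homotopy. -/
theorem Homotopic.reduce_equiv (hX : X.HasFlagLinks) {x y : V} {p q : X.oneSkeleton.Walk x y}
    (h : X.Homotopic p q) : SquareEquiv (reduce p) (reduce q) := by
  induction h with
  | refl p => exact .refl _
  | symm _ ih => exact ih.symm
  | trans _ _ ih ih' => exact ih.trans ih'
  | cons h _ ih => exact prepend_congr hX h ih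
  | backtrack h p => exact prepend_prepend hX h (isReduced_reduce hX p)
  | square hab hbc had hdc p hs =>
    exact prepend_square hX hab hbc had hdc hs _

theorem Homotopic.append_left {x y z : V} (s : X.oneSkeleton.Walk x y)
    {p q : X.oneSkeleton.Walk y z} (h : X.Homotopic p q) :
    X.Homotopic (s.append p) (s.append q) := by
  induction s with
  | nil => exact h
  | cons h' s ih => exact .cons h' (ih h)

theorem homotopic_append_reverse {x y z : V} (s : X.oneSkeleton.Walk x y)
    (p : X.oneSkeleton.Walk x z) : X.Homotopic (s.append (s.reverse.append p)) p := by
  induction s with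
  | nil => exact .refl _
  | cons h s ih =>
    rw [Walk.reverse_cons, ← Walk.append_assoc, Walk.cons_append]
    exact (Homotopic.cons h (ih _)).trans (.backtrack h p)

theorem IsSimplyConnected.homotopic (hX : X.IsSimplyConnected) {x y : V}
    (p q : X.oneSkeleton.Walk x y) : X.Homotopic p q := by
  have h1 := homotopic_append_reverse p q
  have h2 := Homotopic.append_left p (hX.2 _ (p.reverse.append q))
  rw [Walk.append_nil] at h2
  exact h2.symm.trans h1

/-- The two paths are homotopic by simple connectivity, and `reduce` does not change the class of a
reduced path. -/
theorem IsCAT0.squareEquiv (hX : X.IsCAT0) {x y : V} {p q : X.oneSkeleton.Walk x y}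
    (hp : IsReduced p) (hq : IsReduced q) : SquareEquiv p q :=
  ((hp.reduce_equiv hX.2).symm.trans ((hX.1.homotopic p q).reduce_equiv hX.2)).trans
    (hq.reduce_equiv hX.2)

/-! ## Geodesics and hyperplanes -/

theorem isReduced_of_length_eq_dist {x y : V} {p : X.oneSkeleton.Walk x y}
    (hp : p.length = X.oneSkeleton.dist x y) : IsReduced p := by
  induction p with
  | nil => trivial
  | @cons x z y h p ih =>
    rw [Walk.length_cons] at hp
    have h1 : X.oneSkeleton.dist z y ≤ p.length := SimpleGraph.dist_le p
    refine ⟨ih (le_antisymm ?_ h1), fun s hs => ?_⟩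
    · obtain ⟨q, hq⟩ := p.reachable.exists_walk_length_eq_dist
      have := SimpleGraph.dist_le (Walk.cons h q)
      rw [Walk.length_cons] at this
      omega
    · have h2 := hs.length_eq
      have h3 := SimpleGraph.dist_le s
      rw [Walk.length_cons] at h2
      omega

theorem IsCAT0.squareEquiv_of_dist (hX : X.IsCAT0) {x y : V} {p q : X.oneSkeleton.Walk x y}
    (hp : p.length = X.oneSkeleton.dist x y) (hq : q.length = X.oneSkeleton.dist x y) :
    SquareEquiv p q :=
  hX.squareEquiv (isReduced_of_length_eq_dist hp) (isReduced_of_length_eq_dist hq)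

theorem IsCAT0.exists_geodesic (hX : X.IsCAT0) (x y : V) :
    ∃ p : X.oneSkeleton.Walk x y, p.length = X.oneSkeleton.dist x y :=
  hX.1.1.exists_walk_length_eq_dist x y

/-- A geodesic is reduced, so `p` is square equivalent to one and has the same length. -/
theorem IsCAT0.length_eq_dist (hX : X.IsCAT0) {x y : V} {p : X.oneSkeleton.Walk x y}
    (hp : IsReduced p) : p.length = X.oneSkeleton.dist x y := by
  obtain ⟨q, hq⟩ := hX.exists_geodesic x y
  rw [← hq]
  exact (hX.squareEquiv hp (isReduced_of_length_eq_dist hq)).length_eq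

/-- The 1-skeleton is bipartite. -/
theorem IsCAT0.dist_eq_or (hX : X.IsCAT0) {x z : V} (h : X.oneSkeleton.Adj x z) (v : V) :
    X.oneSkeleton.dist x v = X.oneSkeleton.dist z v + 1 ∨
      X.oneSkeleton.dist z v = X.oneSkeleton.dist x v + 1 := by
  obtain ⟨p, hp⟩ := hX.exists_geodesic z v
  -- Either some geodesic from `z` to `v` passes through `x`, or the edge followed by `p` is reduced
  -- and therefore geodesic.
  by_cases hs : ∃ s, SquareEquiv p (Walk.cons h.symm s)
  · obtain ⟨s, hs⟩ := hs
    have h1 := hX.length_eq_dist (hs.isReduced hX.2 (isReduced_of_length_eq_dist hp)).1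
    have h2 := hs.length_eq
    rw [Walk.length_cons] at h2
    omega
  · push Not at hs
    have h1 := hX.length_eq_dist (p := Walk.cons h p) ⟨isReduced_of_length_eq_dist hp, hs⟩
    rw [Walk.length_cons] at h1
    omega

/-- The geodesics from `x` to `v` through `z` and through `w` are square equivalent, so
`SquareEquiv.exists_square` applies. -/
theorem IsCAT0.quadrangle (hX : X.IsCAT0) {x z w v : V} (hzw : z ≠ w)
    (hz : X.oneSkeleton.Adj x z) (hw : X.oneSkeleton.Adj x w)
    (h1 : X.oneSkeleton.dist x v = X.oneSkeleton.dist z v + 1)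
    (h2 : X.oneSkeleton.dist x v = X.oneSkeleton.dist w v + 1) :
    ∃ u, X.IsTwoCube x z u w ∧ X.oneSkeleton.dist z v = X.oneSkeleton.dist u v + 1 := by
  obtain ⟨p, hp⟩ := hX.exists_geodesic z v
  obtain ⟨q, hq⟩ := hX.exists_geodesic w v
  have e : SquareEquiv (Walk.cons hz p) (Walk.cons hw q) :=
    hX.squareEquiv_of_dist (by simp [hp, h1]) (by simp [hq, h2])
  obtain ⟨u, hu, r, h3, -⟩ := e.exists_square hX.2 hzw
  refine ⟨u, hu, ?_⟩
  have h4 := h3.isReduced hX.2 (isReduced_of_length_eq_dist hp)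
  have h5 := hX.length_eq_dist h4.1
  have h6 := h3.length_eq
  rw [Walk.length_cons] at h6
  omega

/-- The vertices that are closer to `a` than to `b`. -/
def closer (X : CubeComplex V) (a b : V) : Set V :=
  {x | X.oneSkeleton.dist a x < X.oneSkeleton.dist b x}

theorem mem_closer {a b x : V} :
    x ∈ X.closer a b ↔ X.oneSkeleton.dist a x < X.oneSkeleton.dist b x := Iff.rfl

/-- Otherwise bipartiteness forces `a` and `c` to be both nearer to `x` than `b` is. The quadrangle
condition at `b` then makes `d` nearer to `x` than `a`, which contradicts the assumed order of the
distances of `c` and `d`. -/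
theorem IsCAT0.closer_subset (hX : X.IsCAT0) {a b c d : V} (h : X.IsTwoCube a b c d) :
    X.closer a b ⊆ X.closer d c := by
  intro x hx
  rw [mem_closer] at hx ⊢
  by_contra hlt
  have hab := hX.dist_eq_or h.2.2.1 x
  have hbc := hX.dist_eq_or h.2.2.2.1 x
  have hcd := hX.dist_eq_or h.2.2.2.2.1 x
  have hda := hX.dist_eq_or h.2.2.2.2.2.1 x
  obtain ⟨u, hu, h1⟩ := hX.quadrangle h.1 h.2.2.1.symm h.2.2.2.1 (v := x) (by omega) (by omega)
  obtain rfl : d = u := h.rotate.reflect.opposite_unique hu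
  omega

theorem IsCAT0.closer_eq (hX : X.IsCAT0) {a b c d : V} (h : X.IsTwoCube a b c d) :
    X.closer a b = X.closer d c :=
  (hX.closer_subset h).antisymm (hX.closer_subset h.reflect.rotate)

/-- The hyperplane dual to a 1-cube. -/
def hyp {x y : V} (h : X.oneSkeleton.Adj x y) : X.Hyperplane := Quot.mk _ ⟨s(x, y), h⟩

theorem hyp_symm {x y : V} (h : X.oneSkeleton.Adj x y) : hyp h.symm = hyp h := by
  unfold hyp
  congr 2
  exact Sym2.eq_swap

theorem exists_hyp (H : X.Hyperplane) : ∃ (x y : V) (h : X.oneSkeleton.Adj x y), hyp h = H := by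
  induction H using Quot.ind with
  | _ e =>
    obtain ⟨e, he⟩ := e
    induction e with
    | _ x y => exact ⟨x, y, he, rfl⟩

theorem IsTwoCube.hyp_eq {a b c d : V} (h : X.IsTwoCube a b c d) (hab : X.oneSkeleton.Adj a b)
    (hdc : X.oneSkeleton.Adj d c) : hyp hab = hyp hdc :=
  Quot.sound ⟨a, b, c, d, h, rfl, rfl⟩

theorem mem_dualEdges {x y : V} (h : X.oneSkeleton.Adj x y) (H : X.Hyperplane) :
    s(x, y) ∈ X.dualEdges H ↔ hyp h = H :=
  ⟨fun ⟨_, h⟩ => h, fun h' => ⟨h, h'⟩⟩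

/-- The unordered pair `{closer a b, closer b a}` is the same for opposite sides of a square, so it
descends to hyperplanes. -/
theorem IsCAT0.closer_of_hyp_eq (hX : X.IsCAT0) {a b c d : V} {h : X.oneSkeleton.Adj a b}
    {h' : X.oneSkeleton.Adj c d} (e : hyp h = hyp h') :
    X.closer a b = X.closer c d ∨ X.closer a b = X.closer d c := by
  let g : Sym2 V → Set (Set V) := Sym2.lift ⟨fun a b => {X.closer a b, X.closer b a},
    fun a b => Set.pair_comm _ _⟩
  let G : X.Hyperplane → Set (Set V) := Quot.lift (fun e => g e) (by
    rintro e f ⟨a, b, c, d, h, he, hf⟩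
    rw [he, hf]
    change ({_, _} : Set (Set V)) = {_, _}
    rw [hX.closer_eq h]
    change ({_, X.closer b a} : Set (Set V)) = {_, X.closer c d}
    rw [hX.closer_eq h.reflect.rotate.rotate.rotate])
  have h1 : G (hyp h) = G (hyp h') := by rw [e]
  change ({_, _} : Set (Set V)) = {_, _} at h1
  have h2 : X.closer a b ∈ ({X.closer c d, X.closer d c} : Set (Set V)) := by rw [← h1]; simp
  simpa using h2

/-- The hyperplanes crossed by an edge path. -/
def hyps : ∀ {x y : V}, X.oneSkeleton.Walk x y → List X.Hyperplane
  | _, _, .nil => []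
  | _, _, .cons h p => hyp h :: hyps p

@[simp] theorem hyps_nil {x : V} : hyps (.nil : X.oneSkeleton.Walk x x) = [] := rfl
@[simp] theorem hyps_cons {x y z : V} (h : X.oneSkeleton.Adj x y) (p : X.oneSkeleton.Walk y z) :
    hyps (.cons h p) = hyp h :: hyps p := rfl

@[simp] theorem length_hyps {x y : V} (p : X.oneSkeleton.Walk x y) :
    (hyps p).length = p.length := by
  induction p with
  | nil => rfl
  | cons h p ih => simp [ih]

/-- A push across a square transposes two consecutive hyperplanes. -/
theorem SquareEquiv.hyps_perm {x y : V} {p q : X.oneSkeleton.Walk x y} (h : SquareEquiv p q) :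
    (hyps p).Perm (hyps q) := by
  induction h with
  | refl p => exact .refl _
  | symm _ ih => exact ih.symm
  | trans _ _ ih ih' => exact ih.trans ih'
  | cons h _ ih => exact ih.cons _
  | square hab hbc had hdc p hs =>
    simp only [hyps_cons]
    rw [hs.hyp_eq hab hdc, hs.reflect.hyp_eq had hbc]
    exact List.Perm.swap _ _ _

theorem exists_of_mem_hyps {x y : V} {p : X.oneSkeleton.Walk x y} {H : X.Hyperplane}
    (hH : H ∈ hyps p) : ∃ (a b : V) (h : X.oneSkeleton.Adj a b), hyp h = H ∧ a ∈ p.support ∧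
      b ∈ p.support := by
  induction p with
  | nil => simp at hH
  | cons h p ih =>
    rw [hyps_cons, List.mem_cons] at hH
    rcases hH with rfl | hH
    · exact ⟨_, _, h, rfl, by simp, by simp⟩
    · obtain ⟨a, b, h', e, ha, hb⟩ := ih hH
      exact ⟨a, b, h', e, by simp [ha], by simp [hb]⟩

theorem dist_add_dist_of_mem_support (hX : X.IsCAT0) {x y c : V} {p : X.oneSkeleton.Walk x y}
    (hp : p.length = X.oneSkeleton.dist x y) (hc : c ∈ p.support) :
    X.oneSkeleton.dist x c + X.oneSkeleton.dist c y = X.oneSkeleton.dist x y := by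
  classical
  have h1 := congrArg Walk.length (p.take_spec hc)
  rw [Walk.length_append] at h1
  have h2 := SimpleGraph.dist_le (p.takeUntil c hc)
  have h3 := SimpleGraph.dist_le (p.dropUntil c hc)
  have h4 := hX.1.1.dist_triangle (u := x) (v := c) (w := y)
  omega

theorem tail_length_eq_dist {x y z : V} {h : X.oneSkeleton.Adj x y} {p : X.oneSkeleton.Walk y z}
    (hp : (Walk.cons h p).length = X.oneSkeleton.dist x z) :
    p.length = X.oneSkeleton.dist y z := by
  refine le_antisymm ?_ (SimpleGraph.dist_le p)
  obtain ⟨q, hq⟩ := p.reachable.exists_walk_length_eq_dist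
  have := SimpleGraph.dist_le (Walk.cons h q)
  rw [Walk.length_cons] at this hp
  omega

/-- A geodesic crosses no hyperplane twice. -/
theorem IsCAT0.nodup_hyps (hX : X.IsCAT0) {x y : V} {p : X.oneSkeleton.Walk x y}
    (hp : p.length = X.oneSkeleton.dist x y) : (hyps p).Nodup := by
  induction p with
  | nil => simp
  | @cons x z y h p ih =>
    have hp' := tail_length_eq_dist hp
    rw [hyps_cons, List.nodup_cons]
    refine ⟨fun hmem => ?_, ih hp'⟩
    obtain ⟨a, b, h', e, ha, hb⟩ := exists_of_mem_hyps hmem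
    -- After its first edge the geodesic never meets the vertices closer to `x` than to `z`, whereas
    -- any edge dual to the same hyperplane has an endpoint among them.
    have key : ∀ c ∈ p.support, c ∉ X.closer x z := by
      intro c hc hlt
      rw [mem_closer] at hlt
      have h1 := dist_add_dist_of_mem_support hX hp' hc
      have h2 := hX.1.1.dist_triangle (u := x) (v := c) (w := y)
      rw [Walk.length_cons] at hp
      omega
    have h0 : ∀ {a b : V}, X.oneSkeleton.Adj a b → a ∈ X.closer a b := by
      intro a b hab
      rw [mem_closer]
      rw [SimpleGraph.dist_self]
      exact hX.1.1.pos_dist_of_ne hab.ne.symm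
    rcases hX.closer_of_hyp_eq e.symm with h1 | h1
    · exact key a ha (h1 ▸ h0 h')
    · exact key b hb (h1 ▸ h0 h'.symm)

/-! ## Hyperplanes separate -/

open Classical in
/-- The hyperplanes that separate `v` from `o`. -/
noncomputable def sep (X : CubeComplex V) (o v : V) : Finset X.Hyperplane :=
  if h : ∃ p : X.oneSkeleton.Walk v o, p.length = X.oneSkeleton.dist v o then
    (hyps h.choose).toFinset else ∅

/-- All geodesics from `v` to `o` cross the same hyperplanes, so the choice made in `sep` is
immaterial. -/
theorem IsCAT0.mem_sep (hX : X.IsCAT0) {o v : V} {p : X.oneSkeleton.Walk v o}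
    (hp : p.length = X.oneSkeleton.dist v o) {K : X.Hyperplane} : K ∈ X.sep o v ↔ K ∈ hyps p := by
  classical
  have h : ∃ p : X.oneSkeleton.Walk v o, p.length = X.oneSkeleton.dist v o := ⟨p, hp⟩
  rw [sep, dif_pos h, List.mem_toFinset]
  exact (hX.squareEquiv_of_dist h.choose_spec hp).hyps_perm.mem_iff

/-- One endpoint is farther from `o`, and a geodesic from it may start with this edge. The rest of
the geodesic does not cross `hyp h` again. -/
theorem IsCAT0.sep_adj (hX : X.IsCAT0) (o : V) {x y : V} (h : X.oneSkeleton.Adj x y)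
    (K : X.Hyperplane) : (K ∈ X.sep o x ↔ K ∈ X.sep o y) ↔ K ≠ hyp h := by
  have key : ∀ {x y : V} (h : X.oneSkeleton.Adj x y),
      X.oneSkeleton.dist x o = X.oneSkeleton.dist y o + 1 →
      ((K ∈ X.sep o x ↔ K ∈ X.sep o y) ↔ K ≠ hyp h) := by
    intro x y h hd
    obtain ⟨p, hp⟩ := hX.exists_geodesic y o
    have hp' : (Walk.cons h p).length = X.oneSkeleton.dist x o := by
      rw [Walk.length_cons]; omega
    have hn := hX.nodup_hyps hp'
    rw [hX.mem_sep hp, hX.mem_sep hp', hyps_cons, List.mem_cons]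
    rw [hyps_cons, List.nodup_cons] at hn
    constructor
    · rintro h1 rfl
      exact hn.1 (h1.1 (Or.inl rfl))
    · intro h1
      simp [h1]
  rcases hX.dist_eq_or h o with hd | hd
  · exact key h hd
  · rw [← hyp_symm h, ← key h.symm hd]
    exact ⟨Iff.symm, Iff.symm⟩

theorem IsCAT0.sep_iff_of_notMem (hX : X.IsCAT0) (o : V) {x y : V} {p : X.oneSkeleton.Walk x y}
    {K : X.Hyperplane} (hK : K ∉ hyps p) : K ∈ X.sep o x ↔ K ∈ X.sep o y := by
  induction p with
  | nil => rfl
  | cons h p ih =>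
    rw [hyps_cons, List.mem_cons, not_or] at hK
    exact ((hX.sep_adj o h K).2 hK.1).trans (ih hK.2)

/-- Membership of `K` changes exactly at the edges dual to `K`, and a geodesic has at most one of
these. -/
theorem IsCAT0.sep_iff (hX : X.IsCAT0) (o : V) {x y : V} {p : X.oneSkeleton.Walk x y}
    (hp : p.length = X.oneSkeleton.dist x y) (K : X.Hyperplane) :
    (K ∈ X.sep o x ↔ K ∈ X.sep o y) ↔ K ∉ hyps p := by
  refine ⟨?_, hX.sep_iff_of_notMem o⟩
  have hn := hX.nodup_hyps hp
  clear hp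
  induction p with
  | nil => simp
  | cons h p ih =>
    rw [hyps_cons, List.nodup_cons] at hn
    rw [hyps_cons, List.mem_cons]
    rintro h1 (rfl | h2)
    · exact ((hX.sep_adj o h _).1 (h1.trans (hX.sep_iff_of_notMem o hn.1).symm)) rfl
    · refine ih hn.2 (((hX.sep_adj o h _).2 ?_).symm.trans h1) h2
      rintro rfl
      exact hn.1 h2

theorem IsCAT0.dist_eq_ncard (hX : X.IsCAT0) (o x y : V) :
    X.oneSkeleton.dist x y = {K | ¬ (K ∈ X.sep o x ↔ K ∈ X.sep o y)}.ncard := by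
  classical
  obtain ⟨p, hp⟩ := hX.exists_geodesic x y
  have : {K | ¬ (K ∈ X.sep o x ↔ K ∈ X.sep o y)} = ((hyps p).toFinset : Set X.Hyperplane) := by
    ext K
    have := hX.sep_iff o hp K
    simp only [Set.mem_ofPred_eq, List.coe_toFinset]
    tauto
  rw [this, Set.ncard_coe_finset, List.toFinset_card_of_nodup (hX.nodup_hyps hp), length_hyps, hp]

/-- A labelling of the vertices by finite sets which embeds the 1-skeleton in a hypercube. -/
structure IsLabelling {P : Type v} (X : CubeComplex V) (L : V → Finset P) : Prop where
  injective : Function.Injective L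
  adj : ∀ {x y : V}, X.oneSkeleton.Adj x y → ∃ H, ∀ K, (K ∈ L x ↔ K ∈ L y) ↔ K ≠ H

theorem IsCAT0.isLabelling (hX : X.IsCAT0) (o : V) : X.IsLabelling (X.sep o) where
  injective x y h := by
    obtain ⟨p, hp⟩ := hX.exists_geodesic x y
    cases p with
    | nil => rfl
    | cons h' p =>
      refine absurd ((hX.sep_iff o hp (hyp h')).1 (by rw [h])) (by simp)
  adj h := ⟨_, hX.sep_adj o h⟩

/-- An edge not dual to `H` does not change the side of `H`, and a geodesic between vertices on the
same side avoids `H`. So the halfspaces are the two sides given by `sep`. -/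
theorem IsCAT0.reachable_iff (hX : X.IsCAT0) (o : V) (H : X.Hyperplane) {x y : V} :
    (X.oneSkeleton.deleteEdges (X.dualEdges H)).Reachable x y ↔
      (H ∈ X.sep o x ↔ H ∈ X.sep o y) := by
  constructor
  · rintro ⟨p⟩
    induction p with
    | nil => rfl
    | cons h p ih =>
      rw [SimpleGraph.deleteEdges_adj] at h
      rw [mem_dualEdges h.1] at h
      exact ((hX.sep_adj o h.1 H).2 fun e => h.2 e.symm).trans ih
  · intro h
    obtain ⟨p, hp⟩ := hX.exists_geodesic x y
    rw [hX.sep_iff o hp] at h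
    clear hp
    induction p with
    | nil => exact .refl _
    | cons h' p ih =>
      rw [hyps_cons, List.mem_cons, not_or] at h
      refine SimpleGraph.Reachable.trans (SimpleGraph.Adj.reachable ?_) (ih h.2)
      rw [SimpleGraph.deleteEdges_adj, mem_dualEdges h']
      exact ⟨h', fun e => h.1 e.symm⟩

theorem IsCAT0.mem_halfspaces (hX : X.IsCAT0) (o : V) (H : X.Hyperplane) (A : Set V) :
    A ∈ X.halfspaces H ↔ ∃ a, A = {x | H ∈ X.sep o x ↔ H ∈ X.sep o a} := by
  constructor
  · rintro ⟨C, rfl⟩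
    induction C using SimpleGraph.ConnectedComponent.ind with
    | _ a =>
    refine ⟨a, ?_⟩
    ext x
    rw [SimpleGraph.ConnectedComponent.mem_supp_iff, SimpleGraph.ConnectedComponent.eq]
    exact hX.reachable_iff o H
  · rintro ⟨a, rfl⟩
    refine ⟨SimpleGraph.connectedComponentMk _ a, ?_⟩
    ext x
    rw [SimpleGraph.ConnectedComponent.mem_supp_iff, SimpleGraph.ConnectedComponent.eq]
    exact (hX.reachable_iff o H).symm

/-- Each side of `H` meets each side of `K` if and only if all combinations occur. -/
theorem IsCAT0.crosses_of (hX : X.IsCAT0) (o : V) {H K : X.Hyperplane}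
    (h : ∀ P Q : Prop, ∃ x, (H ∈ X.sep o x ↔ P) ∧ (K ∈ X.sep o x ↔ Q)) : X.Crosses H K := by
  intro A hA B hB
  obtain ⟨a, rfl⟩ := (hX.mem_halfspaces o H A).1 hA
  obtain ⟨b, rfl⟩ := (hX.mem_halfspaces o K B).1 hB
  exact h _ _

theorem IsCAT0.exists_side (hX : X.IsCAT0) (o : V) (H : X.Hyperplane) (P : Prop) :
    ∃ x, H ∈ X.sep o x ↔ P := by
  obtain ⟨x, y, h, rfl⟩ := exists_hyp H
  have := hX.sep_adj o h (hyp h)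
  by_cases hP : P
  · by_cases hx : hyp h ∈ X.sep o x
    · exact ⟨x, by simp [hx, hP]⟩
    · exact ⟨y, by tauto⟩
  · by_cases hx : hyp h ∈ X.sep o x
    · exact ⟨y, by tauto⟩
    · exact ⟨x, by simp [hx, hP]⟩

theorem IsCAT0.exists_quarter (hX : X.IsCAT0) (o : V) {H K : X.Hyperplane}
    (h : X.Crosses H K) (P Q : Prop) : ∃ x, (H ∈ X.sep o x ↔ P) ∧ (K ∈ X.sep o x ↔ Q) := by
  obtain ⟨a, ha⟩ := hX.exists_side o H P
  obtain ⟨b, hb⟩ := hX.exists_side o K Q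
  obtain ⟨x, hx, hx'⟩ := h _ ((hX.mem_halfspaces o H _).2 ⟨a, rfl⟩) _
    ((hX.mem_halfspaces o K _).2 ⟨b, rfl⟩)
  exact ⟨x, Iff.trans hx ha, Iff.trans hx' hb⟩

/-- The hyperplanes of a 2-cube cross. -/
theorem IsCAT0.crossingGraph_adj_of_square (hX : X.IsCAT0) {a b c d : V}
    (h : X.IsTwoCube a b c d) (hab : X.oneSkeleton.Adj a b) (hbc : X.oneSkeleton.Adj b c) :
    X.crossingGraph.Adj (hyp hab) (hyp hbc) := by
  have hda := h.2.2.2.2.2.1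
  have hdc := h.2.2.2.2.1.symm
  have e1 : hyp hab = hyp hdc := h.hyp_eq _ _
  have e2 : hyp hbc = hyp hda.symm := h.rotate.hyp_eq _ _
  have hne : hyp hab ≠ hyp hbc := by
    intro e
    refine h.1 ((hX.isLabelling a).injective ?_)
    ext K
    have h1 := hX.sep_adj a hab K
    have h2 := hX.sep_adj a hbc K
    rw [e] at h1
    tauto
  refine ⟨hne, hX.crosses_of a fun P Q => ?_⟩
  have hb1 : hyp hab ∈ X.sep a b ↔ ¬ hyp hab ∈ X.sep a a := by
    have := mt (hX.sep_adj a hab (hyp hab)).1 (fun h => h rfl)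
    exact (not_iff.1 this).symm
  have hb2 := (hX.sep_adj a hab (hyp hbc)).2 hne.symm
  have hc1 := (hX.sep_adj a hbc (hyp hab)).2 hne
  have hc2 : hyp hbc ∈ X.sep a c ↔ ¬ hyp hbc ∈ X.sep a b := by
    have := mt (hX.sep_adj a hbc (hyp hbc)).1 (fun h => h rfl)
    exact (not_iff.1 this).symm
  have hd1 := (hX.sep_adj a hda (hyp hab)).2 (by rw [← hyp_symm hda, ← e2]; exact hne)
  have hd2 := (hX.sep_adj a hdc (hyp hbc)).2 (by rw [← e1]; exact hne.symm)
  rw [← hb2] at hc2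
  rw [hc2] at hd2
  rw [hb1] at hc1
  by_cases p1 : (hyp hab ∈ X.sep a a ↔ P) <;> by_cases p2 : (hyp hbc ∈ X.sep a a ↔ Q)
  · exact ⟨a, p1, p2⟩
  · exact ⟨d, hd1.trans p1, hd2.trans (not_iff.1 p2)⟩
  · exact ⟨b, hb1.trans (not_iff.1 p1), hb2.symm.trans p2⟩
  · exact ⟨c, hc1.symm.trans (not_iff.1 p1), hc2.trans (not_iff.1 p2)⟩

/-- A geodesic between the two quarters on the side `Q` of `K` crosses `H` but not `K`, so its edge
dual to `H` lies on this side. -/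
theorem IsCAT0.exists_edge_of_crosses (hX : X.IsCAT0) (o : V) {H K : X.Hyperplane}
    (h : X.Crosses H K) (Q : Prop) : ∃ (x y : V) (e : X.oneSkeleton.Adj x y), hyp e = H ∧
      (K ∈ X.sep o x ↔ Q) := by
  obtain ⟨x, hx, hx'⟩ := hX.exists_quarter o h True Q
  obtain ⟨y, hy, hy'⟩ := hX.exists_quarter o h False Q
  obtain ⟨p, hp⟩ := hX.exists_geodesic x y
  have hH : H ∈ hyps p := by
    by_contra hc
    rw [← hX.sep_iff o hp] at hc
    tauto
  have hK : K ∉ hyps p := by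
    rw [← hX.sep_iff o hp, hx', hy']
  clear hp hx hy hy'
  induction p with
  | nil => simp at hH
  | cons e p ih =>
    rw [hyps_cons, List.mem_cons] at hH hK
    by_cases he : hyp e = H
    · exact ⟨_, _, e, he, hx'⟩
    · refine ih ?_ ?_ ?_
      · have := hX.sep_adj o e K
        tauto
      · rcases hH with hH | hH
        · exact absurd hH.symm he
        · exact hH
      · tauto

/-- Hyperplanes that cross do so in some 2-cube. -/
theorem IsCAT0.exists_square_of_crosses (hX : X.IsCAT0) {H K : X.Hyperplane}
    (h : X.crossingGraph.Adj H K) : ∃ (a b c d : V) (hs : X.IsTwoCube a b c d),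
      hyp hs.2.2.1 = H ∧ hyp hs.2.2.2.1 = K := by
  obtain ⟨o⟩ := hX.1.1.nonempty
  obtain ⟨hne, hc⟩ := h
  by_contra hcon
  push Not at hcon
  obtain ⟨x, y, e, he, hx⟩ := hX.exists_edge_of_crosses o hc True
  obtain ⟨x', y', e', he', hx'⟩ := hX.exists_edge_of_crosses o hc False
  -- If `H` and `K` shared no square, opposite edges dual to `H` would lie on the same side of `K`,
  -- hence so would all edges dual to `H`. But both sides of `K` contain such edges.
  have hstep : ∀ f g : X.oneSkeleton.edgeSet, X.Opposite f g →
      (Quot.mk _ f : X.Hyperplane) = H →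
      ((∀ z ∈ (f : Sym2 V), K ∈ X.sep o z) ↔ ∀ z ∈ (g : Sym2 V), K ∈ X.sep o z) := by
    rintro ⟨f, hf⟩ ⟨g, hg⟩ ⟨a, b, c, d, hs, rfl, rfl⟩ hH
    have h1 := hX.sep_adj o hs.2.2.2.1 K
    have h2 := hX.sep_adj o hs.2.2.2.2.2.1 K
    have h3 := hcon a b c d hs hH
    have h4 := hs.rotate.hyp_eq hs.2.2.2.1 hs.2.2.2.2.2.1.symm
    rw [hyp_symm hs.2.2.2.2.2.1] at h4
    rw [← h4] at h2
    have h1' := h1.2 h3.symm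
    have h2' := h2.2 h3.symm
    simp only [Sym2.mem_iff, forall_eq_or_imp, forall_eq]
    tauto
  have hall : ∀ f g : X.oneSkeleton.edgeSet, Relation.EqvGen X.Opposite f g →
      (Quot.mk _ f : X.Hyperplane) = H →
      ((∀ z ∈ (f : Sym2 V), K ∈ X.sep o z) ↔ ∀ z ∈ (g : Sym2 V), K ∈ X.sep o z) := by
    intro f g hfg
    induction hfg with
    | rel f g h => exact hstep f g h
    | refl f => exact fun _ => Iff.rfl
    | symm f g h ih => exact fun hH => (ih ((Quot.eqvGen_sound h).trans hH)).symm
    | trans f g k h h' ih ih' =>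
      exact fun hH => (ih hH).trans (ih' ((Quot.eqvGen_sound h).symm.trans hH))
  have := hall ⟨s(x, y), e⟩ ⟨s(x', y'), e'⟩ (Quot.eqvGen_exact (he.trans he'.symm)) he
  simp only [Sym2.mem_iff, forall_eq_or_imp, forall_eq] at this
  have h1 := (hX.sep_adj o e K).2 (by rw [he]; exact hne.symm)
  tauto

end CubeComplex

/-! ## Colourings from maps to products of trees -/

theorem SimpleGraph.IsAcyclic.eq_of_adj {W : Type u} {G : SimpleGraph W} (hG : G.IsAcyclic)
    {a b c d : W} (hab : G.Adj a b) (hbc : G.Adj b c) (hcd : G.Adj c d) (hda : G.Adj d a)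
    (hac : a ≠ c) : b = d := by
  let p : G.Path a c := ⟨.cons hab (.cons hbc .nil), by
    simp [SimpleGraph.Walk.isPath_def, hab.ne, hbc.ne, hac]⟩
  let q : G.Path a c := ⟨.cons hda.symm (.cons hcd.symm .nil), by
    simp [SimpleGraph.Walk.isPath_def, hda.ne.symm, hcd.ne.symm, hac]⟩
  have h := congrArg (fun r : G.Path a c => r.1.support) ((hG.subsingleton_path a c).elim p q)
  simp only [p, q, SimpleGraph.Walk.support_cons, SimpleGraph.Walk.support_nil] at h
  simpa using h

/-- Opposite sides of a square in a product of trees have the same direction, and adjacent sides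
have different directions. -/
theorem graphProduct_square {n : ℕ} {W : Fin n → Type u} {T : ∀ i, SimpleGraph (W i)}
    (hT : ∀ i, (T i).IsAcyclic) {a b c d : ∀ i, W i} (hab : (graphProduct T).Adj a b)
    (hbc : (graphProduct T).Adj b c) (hcd : (graphProduct T).Adj c d)
    (hda : (graphProduct T).Adj d a) (hac : a ≠ c) (hbd : b ≠ d) {i : Fin n} (hi : a i ≠ b i) :
    d i ≠ c i ∧ b i = c i := by
  obtain ⟨i', hab, hab'⟩ := hab
  obtain rfl : i = i' := by
    by_contra h
    exact hi (hab' i h)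
  obtain ⟨j, hbc, hbc'⟩ := hbc
  obtain ⟨k, hcd, hcd'⟩ := hcd
  obtain ⟨l, hda, hda'⟩ := hda
  -- If the first two edges had the same direction, so would the other two, and the square would be
  -- a 4-cycle in one tree.
  by_cases hij : i = j
  · subst hij
    have hne : a i ≠ c i := fun h => hac (by
      funext m
      by_cases hm : m = i
      · rw [hm, h]
      · rw [hab' m hm, hbc' m hm])
    exfalso
    have hl : l = i := by
      by_contra hl
      have hk : k = i := by
        by_contra hk
        exact hne ((hda' i (Ne.symm hl)).symm.trans (hcd' i (Ne.symm hk)).symm)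
      exact hda.ne ((hcd' l (by rwa [hk])).symm.trans ((hab' l hl).trans (hbc' l hl)).symm)
    subst hl
    have hk : k = l := by
      by_contra hk
      exact hcd.ne (((hab' k hk).trans (hbc' k hk)).symm.trans (hda' k hk).symm)
    subst hk
    refine hbd ?_
    funext m
    by_cases hm : m = k
    · subst hm
      exact (hT m).eq_of_adj hab hbc hcd hda hne
    · exact (hab' m hm).symm.trans (hda' m hm).symm
  · refine ⟨fun h => ?_, hbc' i hij⟩
    have hl : l = i := by
      by_contra hl
      exact hi ((hda' i (Ne.symm hl)).symm.trans (h.trans (hbc' i hij).symm))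
    subst hl
    refine hbd ?_
    funext m
    by_cases hm : m = l
    · subst hm
      exact (hbc' m hij).trans h.symm
    · exact (hab' m hm).symm.trans (hda' m hm).symm

namespace CubeComplex

variable {V : Type u} {X : CubeComplex V}

/-- The colour of a hyperplane is the factor in which its dual edges move. The assumptions on `f`
are weak enough to cover both isometric embeddings of the graph and combinatorial maps of the
complex. -/
theorem IsCAT0.colorable_of_map (hX : X.IsCAT0) {n : ℕ} {W : Fin n → Type u}
    {T : ∀ i, SimpleGraph (W i)} (hT : ∀ i, (T i).IsAcyclic) (f : V → ∀ i, W i)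
    (hadj : ∀ x y, X.oneSkeleton.Adj x y → (graphProduct T).Adj (f x) (f y))
    (hsq : ∀ a b c d, X.IsTwoCube a b c d → f a ≠ f c) : X.crossingGraph.Colorable n := by
  have hsquare : ∀ {a b c d : V}, X.IsTwoCube a b c d → ∀ i, f a i ≠ f b i →
      f d i ≠ f c i ∧ f b i = f c i := fun {a b c d} h i hi =>
    graphProduct_square hT (hadj _ _ h.2.2.1) (hadj _ _ h.2.2.2.1) (hadj _ _ h.2.2.2.2.1)
      (hadj _ _ h.2.2.2.2.2.1) (hsq _ _ _ _ h) (hsq _ _ _ _ h.rotate) hi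
  have hex : ∀ e : X.oneSkeleton.edgeSet, ∃ i : Fin n, ∀ x y : V,
      (e : Sym2 V) = s(x, y) → f x i ≠ f y i := by
    rintro ⟨e, he⟩
    induction e with
    | _ x y =>
    obtain ⟨i, hi, -⟩ := hadj x y he
    refine ⟨i, fun x' y' h => ?_⟩
    rcases Sym2.eq_iff.1 h with ⟨rfl, rfl⟩ | ⟨rfl, rfl⟩
    · exact hi.ne
    · exact hi.ne.symm
  choose g hg using hex
  have huniq : ∀ (x y : V) (h : X.oneSkeleton.Adj x y) i j, f x i ≠ f y i → f x j ≠ f y j →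
      i = j := by
    intro x y h i j hi hj
    obtain ⟨k, -, hk⟩ := hadj x y h
    have h1 : i = k := by by_contra h; exact hi (hk i h)
    have h2 : j = k := by by_contra h; exact hj (hk j h)
    rw [h1, h2]
  let col : X.Hyperplane → Fin n := Quot.lift g (by
    rintro e e' ⟨a, b, c, d, h, he, he'⟩
    have h1 := (hsquare h _ (hg e a b he)).1
    exact huniq _ _ h.2.2.2.2.1.symm _ _ h1 (hg e' d c he'))
  refine ⟨SimpleGraph.Coloring.mk col fun {H K} hHK => ?_⟩
  obtain ⟨a, b, c, d, h, rfl, rfl⟩ := hX.exists_square_of_crosses hHK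
  intro e
  have h1 := (hsquare h _ (hg ⟨s(a, b), h.2.2.1⟩ a b rfl)).2
  have h2 := hg ⟨s(b, c), h.2.2.2.1⟩ b c rfl
  change g ⟨s(a, b), h.2.2.1⟩ = g ⟨s(b, c), h.2.2.2.1⟩ at e
  rw [← e] at h2
  exact h2 h1

theorem IsCAT0.colorable_of_graphEmbedsInTrees (hX : X.IsCAT0) {k : ℕ}
    (h : GraphEmbedsInTrees X.oneSkeleton k) : X.crossingGraph.Colorable k := by
  obtain ⟨n, hn, W, T, hT, f, hf⟩ := h
  refine (hX.colorable_of_map (fun i => (hT i).isAcyclic) f (fun x y hxy => ?_)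
    fun a b c d h e => ?_).mono hn
  · rw [← SimpleGraph.edist_eq_one_iff_adj, hf, SimpleGraph.edist_eq_one_iff_adj]
    exact hxy
  · have := hf a c
    rw [e, SimpleGraph.edist_self, eq_comm, SimpleGraph.edist_eq_zero_iff] at this
    exact h.1 this

theorem iff_of_not_iff_of_not_iff {a b c : Prop} (h : ¬(a ↔ b)) (h' : ¬(b ↔ c)) : a ↔ c := by
  tauto

/-! ## Labels of the directions of a cube -/

section Labels

variable {P : Type v} {L : V → Finset P}

theorem eq_of_same_label {a b c : V} {p : P} (h : ∀ K, (K ∈ L a ↔ K ∈ L b) ↔ K ≠ p)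
    (h' : ∀ K, (K ∈ L b ↔ K ∈ L c) ↔ K ≠ p) : L a = L c := by
  ext K
  by_cases hK : K = p
  · exact iff_of_not_iff_of_not_iff (fun e => (h K).1 e hK) (fun e => (h' K).1 e hK)
  · exact ((h K).2 hK).trans ((h' K).2 hK)

/-- Around the closed path `a b c d` the membership of `p` changes an even number of times. It
changes on `ab`; a change on `bc` or `ad` would identify two opposite vertices, so it must change on
`dc`. -/
theorem IsLabelling.label_opposite (hL : X.IsLabelling L) {a b c d : V} (hac : a ≠ c) (hbd : b ≠ d)
    {p q r s : P} (hab : ∀ K, (K ∈ L a ↔ K ∈ L b) ↔ K ≠ p)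
    (hbc : ∀ K, (K ∈ L b ↔ K ∈ L c) ↔ K ≠ q) (hdc : ∀ K, (K ∈ L d ↔ K ∈ L c) ↔ K ≠ r)
    (had : ∀ K, (K ∈ L a ↔ K ∈ L d) ↔ K ≠ s) : r = p := by
  by_contra hrp
  have h1 := hab p
  have h2 := hbc p
  have h3 := hdc p
  have h4 := had p
  by_cases hq : p = q
  · subst hq
    exact hac (hL.injective (eq_of_same_label hab hbc))
  · by_cases hs : p = s
    · subst hs
      exact hbd (hL.injective (eq_of_same_label (fun K => iff_comm.trans (hab K)) had))
    · have h1' : ¬(p ∈ L a ↔ p ∈ L b) := fun h => h1.1 h rfl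
      have h2' := h2.2 hq
      have h3' := h3.2 (Ne.symm hrp)
      have h4' := h4.2 hs
      exact h1' (h4'.trans (h3'.trans h2'.symm))

/-- `H` lists the labels of the directions of the cube parametrised by `φ`. -/
def IsDirectionLabel (L : V → Finset P) {d : ℕ} (φ : (Fin d → Bool) → V) (H : Fin d → P) : Prop :=
  ∀ b b' K, (K ∈ L (φ b) ↔ K ∈ L (φ b')) ↔ ∀ i, H i = K → b i = b' i

/-- By `label_opposite` the label of an edge depends only on its direction. Two directions with the
same label would lead from a vertex to the same neighbour. -/
theorem IsLabelling.exists_label (hL : X.IsLabelling L) {d : ℕ} {φ : (Fin d → Bool) → V}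
    (hφ : X.IsChart φ) : ∃ H : Fin d → P, Function.Injective H ∧ IsDirectionLabel L φ H := by
  choose l hl using fun b i => hL.adj (hφ.adj b i)
  have hflip : ∀ i b j, l (flipAt j b) i = l b i := by
    intro i b j
    by_cases hij : i = j
    · subst hij
      have h1 := hl (flipAt i b) i (l b i)
      rw [flipAt_flipAt] at h1
      by_contra h
      exact (hl b i (l b i)).1 (h1.2 (Ne.symm h)).symm rfl
    · have hs := hφ.isTwoCube b hij
      refine hL.label_opposite hs.1 hs.2.1 (hl b i) (q := l (flipAt i b) j) (s := l b j) ?_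
        (hl (flipAt j b) i) (hl b j)
      rw [flipAt_comm i j]
      exact hl _ _
  let H : Fin d → P := fun i => l (fun _ => false) i
  have hlH : ∀ b i, l b i = H i := fun b i =>
    (iff_of_flipAt_iff ∅ (fun b => l b i = H i) (fun b j _ => by rw [hflip]) b (fun _ => false)
      (by simp)).2 rfl
  have hH : Function.Injective H := by
    intro i j hij
    refine flipAt_injective (fun _ => false) (hφ.1 (hL.injective ?_))
    refine eq_of_same_label (p := H j) (b := φ fun _ => false)
      (fun K => iff_comm.trans ?_) fun K => ?_
    · rw [hl (fun _ => false) i K, hlH, hij]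
    · rw [hl (fun _ => false) j K, hlH]
  have hmain : ∀ b b' K, (∀ i, H i = K → b i = b' i) → (K ∈ L (φ b) ↔ K ∈ L (φ b')) :=
    fun b b' K => iff_of_flipAt_iff {i | H i = K} (fun b => K ∈ L (φ b)) (fun b j hj => by
      have := hl b j K
      rw [hlH] at this
      exact (this.2 (fun h => hj h.symm)).symm) b b'
  refine ⟨H, hH, fun b b' K => ⟨?_, hmain b b' K⟩⟩
  rintro h i rfl
  by_contra hi
  have h1 := hmain (flipAt i b) b' (H i) (fun j hj => by
    obtain rfl := hH hj
    rw [flipAt_self]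
    revert hi
    cases b j <;> cases b' j <;> simp)
  have h2 := (hl b i (H i)).1 (h.trans h1.symm)
  rw [hlH] at h2
  exact h2 rfl

theorem IsDirectionLabel.flipAt {d : ℕ} {φ : (Fin d → Bool) → V} {H : Fin d → P}
    (h : IsDirectionLabel L φ H) (b : Fin d → Bool) (i : Fin d) (K : P) :
    (K ∈ L (φ b) ↔ K ∈ L (φ (flipAt i b))) ↔ K ≠ H i := by
  rw [h]
  constructor
  · rintro h' rfl
    have := h' i rfl
    simp at this
  · rintro hne j rfl
    exact (flipAt_of_ne (fun hji => hne (by rw [hji])) b).symm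

theorem IsDirectionLabel.injective {d : ℕ} {φ : (Fin d → Bool) → V} {H : Fin d → P}
    (h : IsDirectionLabel L φ H) : Function.Injective φ := by
  intro b b' hb
  funext i
  exact (h b b' (H i)).1 (by rw [hb]) i rfl

/-- A parametrisation of a cube is a chart if each label corresponds to a coordinate. -/
theorem IsLabelling.isChart (hL : X.IsLabelling L) {d : ℕ} {φ : (Fin d → Bool) → V} {H : Fin d → P}
    (hH : Function.Injective H) (h : IsDirectionLabel L φ H) (hr : Set.range φ ∈ X.cubes) :
    X.IsChart φ := by
  obtain ⟨e, ψ, hψ, hψr⟩ := X.exists_chart _ hr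
  replace hψ : X.IsChart ψ := hψ
  obtain ⟨H', hH', h'⟩ := hL.exists_label hψ
  have hθ : ∀ b, ∃ b', ψ b' = φ b := fun b => by
    have : φ b ∈ Set.range ψ := by rw [hψr]; exact ⟨b, rfl⟩
    exact this
  choose θ hθ using hθ
  have hθs : ∀ b', ∃ b, θ b = b' := fun b' => by
    have : ψ b' ∈ Set.range φ := by rw [← hψr]; exact ⟨b', rfl⟩
    obtain ⟨b, hb⟩ := this
    exact ⟨b, hψ.1 ((hθ b).trans hb)⟩
  -- The labels match the coordinates of `φ` with those of the chart `ψ`. Thus `θ` is a permutation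
  -- of coordinates combined with reflections, and it preserves faces.
  have key : ∀ b b' K, (∀ i, H i = K → b i = b' i) ↔ ∀ j, H' j = K → θ b j = θ b' j := by
    intro b b' K
    rw [← h, ← h', hθ, hθ]
  have hπ : ∀ i, ∃ j, H' j = H i := by
    intro i
    by_contra hc
    push Not at hc
    have := (key (fun _ => false) (flipAt i fun _ => false) (H i)).2
      (fun j hj => absurd hj (hc j)) i rfl
    simp at this
  have hπ' : ∀ j, ∃ i, H i = H' j := by
    intro j
    by_contra hc
    push Not at hc
    obtain ⟨b, hb⟩ := hθs (fun _ => false)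
    obtain ⟨b', hb'⟩ := hθs (flipAt j fun _ => false)
    have := (key b b' (H' j)).1 (fun i hi => absurd hi (hc i)) j rfl
    rw [hb, hb'] at this
    simp at this
  choose π hπ using hπ
  choose ρ hρ using hπ'
  have keyi : ∀ b b' i, b i = b' i ↔ θ b (π i) = θ b' (π i) := by
    intro b b' i
    have := key b b' (H i)
    constructor
    · intro hi
      exact this.1 (fun j hj => by rw [hH hj, hi]) _ (hπ i)
    · intro hi
      exact this.2 (fun j hj => by rw [hH' (hj.trans (hπ i).symm), hi]) _ rfl
  have hπρ : ∀ j, π (ρ j) = j := fun j => hH' ((hπ _).trans (hρ j))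
  have hmem : ∀ τ : Set V, ∀ b, b ∈ φ ⁻¹' τ ↔ θ b ∈ ψ ⁻¹' τ := fun τ b => by
    rw [Set.mem_preimage, Set.mem_preimage, hθ]
  refine ⟨h.injective, fun τ hτ => ?_⟩
  rw [hψ.2 τ (by rw [hψr]; exact hτ)]
  constructor
  · rintro ⟨S, c, hS⟩
    obtain ⟨c, rfl⟩ := hθs c
    refine ⟨{i | π i ∈ S}, c, ?_⟩
    ext b
    rw [hmem, hS]
    constructor
    · intro hb i hi
      exact (keyi b c i).2 (hb _ hi)
    · intro hb j hj
      have := (keyi b c (ρ j)).1 (hb (ρ j) (by rw [Set.mem_ofPred_eq, hπρ]; exact hj))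
      rwa [hπρ] at this
  · rintro ⟨S, c, hS⟩
    refine ⟨π '' S, θ c, ?_⟩
    ext b'
    obtain ⟨b, rfl⟩ := hθs b'
    rw [← hmem, hS]
    constructor
    · rintro hb _ ⟨i, hi, rfl⟩
      exact (keyi b c i).1 (hb i hi)
    · intro hb i hi
      exact (keyi b c i).2 (hb _ ⟨i, hi, rfl⟩)

theorem IsCAT0.crossingGraph_adj_of_label (hX : X.IsCAT0) (o : V) {d : ℕ}
    {φ : (Fin d → Bool) → V} (hφ : X.IsChart φ) {H : Fin d → X.Hyperplane}
    (h : IsDirectionLabel (X.sep o) φ H) {i j : Fin d} (hij : i ≠ j) :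
    X.crossingGraph.Adj (H i) (H j) := by
  have key : ∀ b i (e : X.oneSkeleton.Adj (φ b) (φ (flipAt i b))), hyp e = H i := by
    intro b i e
    have h1 := h.flipAt b i (hyp e)
    rw [hX.sep_adj o e] at h1
    by_contra hne
    exact h1.2 hne rfl
  have hs := hφ.isTwoCube (fun _ => false) hij
  have h1 := hX.crossingGraph_adj_of_square hs hs.2.2.1 hs.2.2.2.1
  rw [key] at h1
  convert h1 using 1
  rw [← key (flipAt i fun _ => false) j (hφ.adj _ _)]
  congr 2
  rw [flipAt_comm]

end Labels

/-! ## The trees of a colouring -/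

theorem exists_quarter_of {V : Type u} {h k : V → Prop} {x₁ x₂ x₃ x₄ : V} (h1 : ¬(h x₁ ↔ h x₂))
    (h2 : k x₁ ↔ k x₂) (h3 : ¬(h x₃ ↔ h x₄)) (h4 : k x₃ ↔ k x₄) (h5 : h x₁ ↔ h x₃)
    (h6 : ¬(k x₁ ↔ k x₃)) (P Q : Prop) : ∃ x, (h x ↔ P) ∧ (k x ↔ Q) := by
  by_cases p : h x₁ ↔ P <;> by_cases q : k x₁ ↔ Q
  · exact ⟨x₁, p, q⟩
  · exact ⟨x₃, h5.symm.trans p, iff_of_not_iff_of_not_iff (mt Iff.symm h6) q⟩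
  · exact ⟨x₂, iff_of_not_iff_of_not_iff (mt Iff.symm h1) p, h2.symm.trans q⟩
  · exact ⟨x₄, iff_of_not_iff_of_not_iff (mt Iff.symm h3) fun e => p (h5.trans e),
      h4.symm.trans (iff_of_not_iff_of_not_iff (mt Iff.symm h6) q)⟩

section Trees

variable {k : ℕ}

open Classical in
/-- The vertices of the tree of the colour `i`: the sets of the hyperplanes of this colour that
separate some vertex from `o`. -/
def TreeVertex (X : CubeComplex V) (o : V) (c : X.Hyperplane → Fin k) (i : Fin k) : Type u :=
  {g : Finset X.Hyperplane // ∃ v, g = (X.sep o v).filter fun K => c K = i}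

/-- The tree of the colour `i`: two vertices are adjacent if they differ in one hyperplane. -/
def colourTree (X : CubeComplex V) (o : V) (c : X.Hyperplane → Fin k) (i : Fin k) :
    SimpleGraph (TreeVertex X o c i) where
  Adj g g' := ∃ H, ∀ K, (K ∈ g.1 ↔ K ∈ g'.1) ↔ K ≠ H
  symm := ⟨fun _ _ ⟨H, h⟩ => ⟨H, fun K => iff_comm.trans (h K)⟩⟩
  loopless := ⟨fun _ ⟨H, h⟩ => (h H).1 Iff.rfl rfl⟩

open Classical in
/-- The projection to the tree of the colour `i`. -/
noncomputable def toTree (X : CubeComplex V) (o : V) (c : X.Hyperplane → Fin k) (v : V)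
    (i : Fin k) : TreeVertex X o c i :=
  ⟨(X.sep o v).filter fun K => c K = i, v, rfl⟩

theorem mem_toTree {o v : V} {c : X.Hyperplane → Fin k} {i : Fin k} {K : X.Hyperplane} :
    K ∈ (toTree X o c v i).1 ↔ K ∈ X.sep o v ∧ c K = i := by
  simp [toTree]

theorem exists_toTree {o : V} {c : X.Hyperplane → Fin k} {i : Fin k} (g : TreeVertex X o c i) :
    ∃ v, g = toTree X o c v i := by
  obtain ⟨g, v, rfl⟩ := g
  exact ⟨v, rfl⟩

theorem toTree_eq_iff {o v w : V} {c : X.Hyperplane → Fin k} {i : Fin k} :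
    toTree X o c v i = toTree X o c w i ↔
      ∀ K, c K = i → (K ∈ X.sep o v ↔ K ∈ X.sep o w) := by
  refine (show _ ↔ (toTree X o c v i).1 = (toTree X o c w i).1 from Subtype.ext_iff).trans ?_
  rw [Finset.ext_iff]
  simp only [mem_toTree]
  exact ⟨fun h K hK => by simpa [hK] using h K, fun h K => and_congr_left (h K)⟩

theorem toTree_adj {o v w : V} {c : X.Hyperplane → Fin k} {i : Fin k} {H : X.Hyperplane}
    (hH : c H = i) (h : ∀ K, (K ∈ X.sep o v ↔ K ∈ X.sep o w) ↔ K ≠ H) :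
    (colourTree X o c i).Adj (toTree X o c v i) (toTree X o c w i) := by
  refine ⟨H, fun K => ?_⟩
  rw [mem_toTree, mem_toTree, ← h K]
  by_cases hK : c K = i
  · simp [hK]
  · have : K ≠ H := by rintro rfl; exact hK hH
    simp [hK, (h K).2 this]

theorem IsCAT0.toTree_eq (hX : X.IsCAT0) {o v w : V} {c : X.Hyperplane → Fin k} {i : Fin k}
    (h : X.oneSkeleton.Adj v w) (hi : c (hyp h) ≠ i) : toTree X o c v i = toTree X o c w i := by
  rw [toTree_eq_iff]
  rintro K rfl
  exact (hX.sep_adj o h K).2 (by rintro rfl; exact hi rfl)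

theorem IsCAT0.graphProduct_adj (hX : X.IsCAT0) {o v w : V} (c : X.Hyperplane → Fin k)
    (h : X.oneSkeleton.Adj v w) :
    (graphProduct (colourTree X o c)).Adj (toTree X o c v) (toTree X o c w) :=
  ⟨c (hyp h), toTree_adj rfl (hX.sep_adj o h), fun _ hj => hX.toTree_eq h hj.symm⟩

theorem IsCAT0.colourTree_connected (hX : X.IsCAT0) (o : V) (c : X.Hyperplane → Fin k)
    (i : Fin k) : (colourTree X o c i).Connected := by
  have : Nonempty (TreeVertex X o c i) := ⟨toTree X o c o i⟩
  refine SimpleGraph.Connected.mk fun g g' => ?_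
  obtain ⟨v, rfl⟩ := exists_toTree g
  obtain ⟨w, rfl⟩ := exists_toTree g'
  obtain ⟨p⟩ := hX.1.1.preconnected v w
  induction p with
  | nil => exact .refl _
  | cons h p ih =>
    refine SimpleGraph.Reachable.trans ?_ ih
    by_cases hi : c (hyp h) = i
    · exact (toTree_adj hi (hX.sep_adj o h)).reachable
    · rw [hX.toTree_eq h hi]

/-- If `g₁ ≠ g₃`, some `K` of the colour `i` separates them. Both edges cross `H` and lie on
different sides of `K`, so `H` and `K` cross although they have the same colour. -/
theorem IsCAT0.colourTree_eq (hX : X.IsCAT0) {o : V} {c : X.Hyperplane → Fin k}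
    (hc : ∀ H K, X.crossingGraph.Adj H K → c H ≠ c K) {i : Fin k} {H : X.Hyperplane}
    {g₁ g₂ g₃ g₄ : TreeVertex X o c i} (h : ∀ K, (K ∈ g₁.1 ↔ K ∈ g₂.1) ↔ K ≠ H)
    (h' : ∀ K, (K ∈ g₃.1 ↔ K ∈ g₄.1) ↔ K ≠ H) (hH : H ∈ g₁.1 ↔ H ∈ g₃.1) : g₁ = g₃ := by
  obtain ⟨x₁, rfl⟩ := exists_toTree g₁
  obtain ⟨x₂, rfl⟩ := exists_toTree g₂
  obtain ⟨x₃, rfl⟩ := exists_toTree g₃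
  obtain ⟨x₄, rfl⟩ := exists_toTree g₄
  simp only [mem_toTree] at h h' hH
  have hHi : c H = i := by
    by_contra hne
    exact (h H).1 (by simp [hne]) rfl
  rw [toTree_eq_iff]
  rintro K hKi
  by_contra hK
  have hKH : K ≠ H := by
    rintro rfl
    simp only [hHi, and_true] at hH
    exact hK hH
  refine hc H K ⟨hKH.symm, hX.crosses_of o fun P Q => ?_⟩ (hHi.trans hKi.symm)
  have h1 := h H
  have h2 := (h K).2 hKH
  have h3 := h' H
  have h4 := (h' K).2 hKH
  simp only [hHi, hKi, and_true, ne_eq, not_true_eq_false, iff_false] at h1 h2 h3 h4 hH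
  exact exists_quarter_of (h := fun x => H ∈ X.sep o x) (k := fun x => K ∈ X.sep o x)
    h1 h2 h3 h4 hH hK P Q

/-- By `colourTree_eq` each hyperplane labels at most one edge. Without this edge no path changes
the membership of the hyperplane, so every edge is a bridge. -/
theorem IsCAT0.colourTree_isTree (hX : X.IsCAT0) (o : V) {c : X.Hyperplane → Fin k}
    (hc : ∀ H K, X.crossingGraph.Adj H K → c H ≠ c K) (i : Fin k) :
    (colourTree X o c i).IsTree := by
  refine ⟨hX.colourTree_connected o c i, ?_⟩
  rw [SimpleGraph.isAcyclic_iff_forall_adj_isBridge]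
  intro u v huv
  rw [SimpleGraph.isBridge_iff]
  obtain ⟨H, hH⟩ := huv
  rintro ⟨p⟩
  refine (hH H).1 ?_ rfl
  have key : ∀ {g g' : TreeVertex X o c i}
      (p : ((colourTree X o c i).deleteEdges {s(u, v)}).Walk g g'), H ∈ g.1 ↔ H ∈ g'.1 := by
    intro g g' p
    induction p with
    | nil => rfl
    | @cons g g₁ _ h p ih =>
      refine Iff.trans ?_ ih
      rw [SimpleGraph.deleteEdges_adj] at h
      obtain ⟨⟨H', hH'⟩, hne⟩ := h
      by_contra hiff
      obtain rfl : H = H' := by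
        by_contra hne
        exact hiff ((hH' H).2 hne)
      have hsymm := fun K => iff_comm.trans (hH K)
      have hsymm' := fun K => iff_comm.trans (hH' K)
      refine hne ?_
      have huvH : ¬(H ∈ u.1 ↔ H ∈ v.1) := fun e => (hH H).1 e rfl
      by_cases hu : H ∈ g.1 ↔ H ∈ u.1
      · have e1 := hX.colourTree_eq hc hH' hH hu
        have e2 := hX.colourTree_eq hc hsymm' hsymm (by tauto)
        rw [e1, e2]; rfl
      · have e1 := hX.colourTree_eq hc hH' hsymm (by tauto)
        have e2 := hX.colourTree_eq hc hsymm' hH (by tauto)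
        rw [e1, e2, Sym2.eq_swap]; rfl
  exact key p

end Trees

/-! ## Products of trees -/

theorem graphProduct_adj_of_pi {n : ℕ} {W : Fin n → Type u} {T : ∀ i, SimpleGraph (W i)}
    {x y : ∀ i, W i} (h : (pi fun i => ofGraph (T i)).oneSkeleton.Adj x y) :
    (graphProduct T).Adj x y := by
  obtain ⟨hne, s, hs, h⟩ := h
  have hx : ∀ i, x i ∈ s i := fun i => by
    have : x ∈ Set.univ.pi s := by rw [← h]; simp
    exact this i trivial
  have hy : ∀ i, y i ∈ s i := fun i => by
    have : y ∈ Set.univ.pi s := by rw [← h]; simp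
    exact this i trivial
  obtain ⟨i, hi⟩ := Function.ne_iff.1 hne
  refine ⟨i, ?_, fun j hj => ?_⟩
  · rcases hs i with ⟨v, hv⟩ | ⟨v, w, hvw, hv⟩
    · have h1 := hx i
      have h2 := hy i
      rw [hv, Set.mem_singleton_iff] at h1 h2
      exact absurd (h1.trans h2.symm) hi
    · have h1 := hx i
      have h2 := hy i
      rw [hv] at h1 h2
      rcases h1 with h1 | h1 <;> rcases h2 with h2 | h2
      · exact absurd (h1.trans h2.symm) hi
      · rw [h1, h2]; exact hvw
      · rw [h1, h2]; exact hvw.symm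
      · exact absurd (h1.trans h2.symm) hi
  · have h1 : Function.update x i (y i) ∈ Set.univ.pi s := by
      intro k _
      by_cases hk : k = i
      · subst hk; simpa using hy k
      · simpa [hk] using hx k
    rw [← h] at h1
    rcases h1 with h1 | h1
    · have := congrFun h1 i
      rw [Function.update_self] at this
      exact absurd this.symm hi
    · have := congrFun h1 j
      rwa [Function.update_of_ne hj] at this

section Trees

variable {k : ℕ} {o : V} {c : X.Hyperplane → Fin k}

open Classical in
/-- The hyperplanes that separate a vertex of the product of the trees from the base vertex. -/
noncomputable def treeLabel (y : ∀ i, TreeVertex X o c i) : Finset X.Hyperplane :=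
  Finset.univ.biUnion fun i => (y i).1

theorem colour_of_mem {i : Fin k} {g : TreeVertex X o c i} {K : X.Hyperplane} (hK : K ∈ g.1) :
    c K = i := by
  obtain ⟨v, rfl⟩ := exists_toTree g
  exact (mem_toTree.1 hK).2

theorem mem_treeLabel {y : ∀ i, TreeVertex X o c i} {K : X.Hyperplane} :
    K ∈ treeLabel y ↔ K ∈ (y (c K)).1 := by
  simp only [treeLabel, Finset.mem_biUnion, Finset.mem_univ, true_and]
  constructor
  · rintro ⟨i, hi⟩
    obtain rfl := colour_of_mem hi
    exact hi
  · exact fun h => ⟨_, h⟩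

theorem treeLabel_toTree (v : V) : treeLabel (toTree X o c v) = X.sep o v := by
  ext K
  rw [mem_treeLabel, mem_toTree]
  simp

theorem treeLabel_injective :
    Function.Injective (treeLabel : (∀ i, TreeVertex X o c i) → Finset X.Hyperplane) := by
  intro x y h
  funext i
  refine Subtype.ext (Finset.ext fun K => ?_)
  by_cases hK : c K = i
  · subst hK
    rw [← mem_treeLabel, ← mem_treeLabel, h]
  · exact ⟨fun h => absurd (colour_of_mem h) hK, fun h => absurd (colour_of_mem h) hK⟩

theorem exists_label_of_graphProduct_adj {x y : ∀ i, TreeVertex X o c i}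
    (h : (graphProduct (colourTree X o c)).Adj x y) :
    ∃ H, ∀ K, (K ∈ treeLabel x ↔ K ∈ treeLabel y) ↔ K ≠ H := by
  obtain ⟨i, ⟨H, hH⟩, h⟩ := h
  have hHi : c H = i := by
    by_contra hne
    exact (hH H).1 ⟨fun h => absurd (colour_of_mem h) hne,
      fun h => absurd (colour_of_mem h) hne⟩ rfl
  refine ⟨H, fun K => ?_⟩
  rw [mem_treeLabel, mem_treeLabel]
  by_cases hK : c K = i
  · subst hK
    exact hH K
  · rw [h _ hK]
    simp only [true_iff]
    rintro rfl
    exact hK hHi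

theorem isLabelling_treeLabel :
    (pi fun i => ofGraph (colourTree X o c i)).IsLabelling (treeLabel (o := o) (c := c)) where
  injective := treeLabel_injective
  adj h := exists_label_of_graphProduct_adj (graphProduct_adj_of_pi h)

/-- The directions of a cube cross pairwise and so have different colours. Each tree therefore sees
at most one of them, and the image of the cube in it is a vertex or an edge. -/
theorem IsCAT0.isChart_toTree (hX : X.IsCAT0)
    (hc : ∀ H K, X.crossingGraph.Adj H K → c H ≠ c K) {d : ℕ} {φ : (Fin d → Bool) → V}
    (hφ : X.IsChart φ) :
    (pi fun i => ofGraph (colourTree X o c i)).IsChart (toTree X o c ∘ φ) := by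
  obtain ⟨H, hH, h⟩ := (hX.isLabelling o).exists_label hφ
  have hE : ∀ i b b', toTree X o c (φ b) i = toTree X o c (φ b') i ↔
      ∀ j, c (H j) = i → b j = b' j := by
    intro i b b'
    rw [toTree_eq_iff]
    constructor
    · intro h' j hj
      exact (h b b' (H j)).1 (h' _ hj) j rfl
    · intro h' K hK
      rw [h]
      rintro j rfl
      exact h' j hK
  refine isLabelling_treeLabel.isChart hH (fun b b' K => ?_) ?_
  · rw [Function.comp_apply, Function.comp_apply, treeLabel_toTree, treeLabel_toTree]
    exact h b b' K
  refine ⟨fun i => Set.range fun b => toTree X o c (φ b) i, fun i => ?_, ?_⟩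
  · by_cases hj : ∃ j, c (H j) = i
    · obtain ⟨j, hj⟩ := hj
      have huniq : ∀ j', c (H j') = i → j' = j := by
        intro j' hj'
        by_contra hne
        exact hc _ _ (hX.crossingGraph_adj_of_label o hφ h hne) (hj'.trans hj.symm)
      right
      refine ⟨_, _, toTree_adj hj (h.flipAt (fun _ => false) j), ?_⟩
      ext g
      constructor
      · rintro ⟨b, rfl⟩
        by_cases hb : b j = false
        · left
          rw [hE]
          intro j' hj'
          rw [huniq j' hj', hb]
        · right
          rw [Set.mem_singleton_iff, hE]
          intro j' hj'
          rw [huniq j' hj', flipAt_self]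
          simpa using hb
      · rintro (rfl | rfl) <;> exact ⟨_, rfl⟩
    · left
      refine ⟨toTree X o c (φ fun _ => false) i, ?_⟩
      ext g
      constructor
      · rintro ⟨b, rfl⟩
        rw [Set.mem_singleton_iff, hE]
        exact fun j hj' => absurd ⟨j, hj'⟩ hj
      · rintro rfl
        exact ⟨_, rfl⟩
  · ext y
    constructor
    · rintro ⟨b, rfl⟩ i _
      exact ⟨b, rfl⟩
    · intro hy
      choose b hb using fun i => hy i trivial
      -- The `j`-th coordinate is visible only in the tree of the colour of `H j`, so it is copied
      -- from the vertex chosen for that tree.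
      refine ⟨fun j => b (c (H j)) j, ?_⟩
      funext i
      rw [← hb i]
      refine (hE i _ _).2 ?_
      rintro j rfl
      rfl

theorem ncard_le_length {x y : ∀ i, TreeVertex X o c i}
    (p : (graphProduct (colourTree X o c)).Walk x y) :
    {K | ¬(K ∈ treeLabel x ↔ K ∈ treeLabel y)}.ncard ≤ p.length := by
  induction p with
  | nil => simp
  | @cons x y z h p ih =>
    obtain ⟨H, hH⟩ := exists_label_of_graphProduct_adj h
    have hfin : {K | ¬(K ∈ treeLabel y ↔ K ∈ treeLabel z)}.Finite := by
      refine ((treeLabel y).finite_toSet.union (treeLabel z).finite_toSet).subset fun K hK => ?_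
      rw [Set.mem_ofPred_eq] at hK
      simp only [Set.mem_union, Finset.mem_coe]
      tauto
    rw [SimpleGraph.Walk.length_cons]
    refine (Set.ncard_le_ncard (t := insert H {K | ¬(K ∈ treeLabel y ↔ K ∈ treeLabel z)})
      (fun K hK => ?_) (hfin.insert H)).trans ((Set.ncard_insert_le _ _).trans (by omega))
    rw [Set.mem_insert_iff]
    by_cases hKH : K = H
    · exact Or.inl hKH
    · exact Or.inr fun e => hK (((hH K).2 hKH).trans e)

/-- Edges go to edges, which bounds the distance from above. From below, each step in the product
changes one label, and the number of labels that differ is the distance in `X`. -/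
theorem IsCAT0.edist_toTree (hX : X.IsCAT0) (o : V) (c : X.Hyperplane → Fin k) (x y : V) :
    (graphProduct (colourTree X o c)).edist (toTree X o c x) (toTree X o c y) =
      X.oneSkeleton.edist x y := by
  obtain ⟨p, hp⟩ := hX.1.1.exists_walk_length_eq_edist x y
  apply le_antisymm
  · let F : X.oneSkeleton →g graphProduct (colourTree X o c) :=
      ⟨toTree X o c, fun h => hX.graphProduct_adj c h⟩
    rw [← hp, ← SimpleGraph.Walk.length_map F p]
    exact SimpleGraph.edist_le _
  · refine le_iInf fun q => ?_
    rw [← (hX.1.1.preconnected x y).coe_dist_eq_edist, hX.dist_eq_ncard o, ← treeLabel_toTree (c := c) x,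
      ← treeLabel_toTree (c := c) y]
    exact_mod_cast ncard_le_length q

theorem IsCAT0.graphEmbedsInTrees (hX : X.IsCAT0) (h : X.crossingGraph.Colorable k) :
    GraphEmbedsInTrees X.oneSkeleton k := by
  obtain ⟨o⟩ := hX.1.1.nonempty
  obtain ⟨c⟩ := h
  exact ⟨k, le_rfl, TreeVertex X o c, colourTree X o c,
    fun i => hX.colourTree_isTree o (fun _ _ h => c.valid h) i, toTree X o c,
    hX.edist_toTree o c⟩

end Trees

/-! ## Coordinates on the realization -/

/-- The multilinear weight of the vertex `b` at the point `x` of the standard cube. -/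
noncomputable def vertexWeight {d : ℕ} (x : Fin d → unitInterval) (b : Fin d → Bool) : ℝ :=
  ∏ i, if b i then (x i : ℝ) else 1 - (x i : ℝ)

theorem sum_vertexWeight {d : ℕ} (x : Fin d → unitInterval) : ∑ b, vertexWeight x b = 1 := by
  -- Expansion of the product of the factors `x i + (1 - x i) = 1`.
  have h := Finset.prod_univ_sum (fun _ : Fin d => (Finset.univ : Finset Bool))
    (fun i c => if c then (x i : ℝ) else 1 - (x i : ℝ))
  rw [Fintype.piFinset_univ] at h
  unfold vertexWeight
  rw [← h]
  simp

theorem sum_vertexWeight_true {d : ℕ} (x : Fin d → unitInterval) (i : Fin d) :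
    (∑ b, if b i = true then vertexWeight x b else 0) = x i := by
  -- The same expansion, with the summand `1 - x i` of the `i`-th factor suppressed.
  have h := Finset.prod_univ_sum (fun _ : Fin d => (Finset.univ : Finset Bool))
    (fun j c => (if c then (x j : ℝ) else 1 - (x j : ℝ)) * if j = i then (if c then 1 else 0) else 1)
  rw [Fintype.piFinset_univ] at h
  have h1 : ∀ b : Fin d → Bool, (if b i = true then vertexWeight x b else 0) =
      ∏ j, ((if b j then (x j : ℝ) else 1 - (x j : ℝ)) *
        if j = i then (if b j then 1 else 0) else 1) := by
    intro b
    rw [Finset.prod_mul_distrib, Finset.prod_ite_eq' Finset.univ i fun j => if b j then (1 : ℝ) else 0]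
    simp [vertexWeight]
  rw [Finset.sum_congr rfl fun b _ => h1 b, ← h, Finset.prod_eq_single i]
  · simp
  · intro j _ hj
    simp [hj]
  · simp

theorem sum_vertexWeight_false {d : ℕ} (x : Fin d → unitInterval) (i : Fin d) :
    (∑ b, if b i = false then vertexWeight x b else 0) = 1 - (x i : ℝ) := by
  rw [← sum_vertexWeight x, ← sum_vertexWeight_true x i, ← Finset.sum_sub_distrib]
  refine Finset.sum_congr rfl fun b _ => ?_
  cases b i <;> simp

section Coord

variable {P : Type v} {L : V → Finset P}

theorem cubeWeight_apply {d : ℕ} {φ : (Fin d → Bool) → V} (hφ : Function.Injective φ)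
    (x : Fin d → unitInterval) (b : Fin d → Bool) : cubeWeight φ x (φ b) = vertexWeight x b := by
  classical
  unfold cubeWeight vertexWeight
  rw [Finset.sum_eq_single b]
  · simp
  · intro b' _ hb'
    rw [if_neg fun h => hb' (hφ h)]
  · simp

theorem cubeWeight_of_notMem {d : ℕ} {φ : (Fin d → Bool) → V} (x : Fin d → unitInterval) {v : V}
    (hv : v ∉ Set.range φ) : cubeWeight φ x v = 0 := by
  classical
  unfold cubeWeight
  refine Finset.sum_eq_zero fun b _ => ?_
  rw [if_neg fun h => hv ⟨b, h⟩]

open Classical in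
/-- The coordinate of a point with respect to the label `K`: the total weight of the vertices
with this label. -/
noncomputable def coord (L : V → Finset P) (p : X.Realization) (K : P) : ℝ :=
  ∑ᶠ v, if K ∈ L v then p.weight v else 0

open Classical in
theorem coord_point {d : ℕ} {φ : (Fin d → Bool) → V} (hφ : X.IsChart φ) (x : Fin d → unitInterval)
    (K : P) : coord L (X.point φ hφ x) K = ∑ b, if K ∈ L (φ b) then vertexWeight x b else 0 := by
  unfold coord
  rw [finsum_eq_sum_of_support_subset (s := Finset.univ.image φ), Finset.sum_image hφ.1.injOn]
  · refine Finset.sum_congr rfl fun b _ => ?_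
    change (if _ then cubeWeight φ x (φ b) else 0) = _
    rw [cubeWeight_apply hφ.1]
  · intro v hv
    by_contra hv'
    refine hv ?_
    change (if _ then cubeWeight φ x v else 0) = 0
    rw [cubeWeight_of_notMem x (by simpa using hv'), ite_self]

open Classical in
theorem coord_point_of_ne {d : ℕ} {φ : (Fin d → Bool) → V} {H : Fin d → P} (hφ : X.IsChart φ)
    (h : IsDirectionLabel L φ H) (x : Fin d → unitInterval) {K : P} (hK : ∀ i, H i ≠ K)
    (b : Fin d → Bool) : coord L (X.point φ hφ x) K = if K ∈ L (φ b) then 1 else 0 := by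
  rw [coord_point]
  have h1 : ∀ b', K ∈ L (φ b') ↔ K ∈ L (φ b) := fun b' =>
    (h b' b K).2 fun i hi => absurd hi (hK i)
  simp only [h1]
  split_ifs
  · exact sum_vertexWeight x
  · simp

theorem IsDirectionLabel.mem_iff {d : ℕ} {φ : (Fin d → Bool) → V} {H : Fin d → P}
    (h : IsDirectionLabel L φ H) (hH : Function.Injective H) (i : Fin d) (b b' : Fin d → Bool) :
    (H i ∈ L (φ b) ↔ H i ∈ L (φ b')) ↔ b i = b' i := by
  rw [h]
  exact ⟨fun h' => h' i rfl, fun h' j hj => by rw [hH hj, h']⟩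

open Classical in
theorem coord_point_label {d : ℕ} {φ : (Fin d → Bool) → V} {H : Fin d → P} (hφ : X.IsChart φ)
    (hH : Function.Injective H) (h : IsDirectionLabel L φ H) (x : Fin d → unitInterval) (i : Fin d) :
    coord L (X.point φ hφ x) (H i) =
      if H i ∈ L (φ fun _ => true) then (x i : ℝ) else 1 - (x i : ℝ) := by
  rw [coord_point]
  split_ifs with hi
  · rw [← sum_vertexWeight_true x i]
    refine Finset.sum_congr rfl fun b _ => if_congr ?_ rfl rfl
    rw [← h.mem_iff hH i b fun _ => true]
    simp [hi]
  · rw [← sum_vertexWeight_false x i]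
    refine Finset.sum_congr rfl fun b _ => if_congr ?_ rfl rfl
    rw [← Bool.not_eq_true, ← h.mem_iff hH i b fun _ => true]
    simp [hi]

open Classical in
/-- The coordinates of a point determine its weights. -/
theorem IsLabelling.weight_eq (hL : X.IsLabelling L) (p : X.Realization) (v : V) :
    p.weight v = ∏ᶠ K, if K ∈ L v then coord L p K else 1 - coord L p K := by
  obtain ⟨w, d, φ, x, hφ, rfl⟩ := p
  change cubeWeight φ x v = ∏ᶠ K, if K ∈ L v then coord L (X.point φ hφ x) K else
    1 - coord L (X.point φ hφ x) K
  obtain ⟨H, hH, h⟩ := hL.exists_label hφ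
  by_cases hv : v ∈ Set.range φ
  · obtain ⟨b, rfl⟩ := hv
    rw [cubeWeight_apply hφ.1, finprod_eq_prod_of_mulSupport_subset (s := Finset.univ.image H),
      Finset.prod_image hH.injOn]
    · refine Finset.prod_congr rfl fun i _ => ?_
      rw [coord_point_label hφ hH h]
      have := h.mem_iff hH i b fun _ => true
      by_cases h1 : H i ∈ L (φ b) <;> by_cases h2 : H i ∈ L (φ fun _ => true) <;>
        simp [h1, h2] at this <;> simp [h1, h2, this]
    · intro K hK
      by_contra hK'
      refine hK ?_
      change (if _ then _ else _) = _
      rw [coord_point_of_ne hφ h x (by simpa using hK') b]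
      by_cases h1 : K ∈ L (φ b) <;> simp [h1]
  · rw [cubeWeight_of_notMem x hv]
    -- A vertex outside the cube differs from it in some label that is not a direction of the cube;
    -- otherwise it would be the vertex of the cube with the same labels in all directions. This
    -- label contributes the factor `0`.
    have hex : ∃ K, (∀ i, H i ≠ K) ∧ ¬(K ∈ L v ↔ K ∈ L (φ fun _ => true)) := by
      by_contra hcon
      push Not at hcon
      refine hv ⟨fun i => decide (H i ∈ L v ↔ H i ∈ L (φ fun _ => true)), hL.injective ?_⟩
      ext K
      by_cases hK : ∃ i, H i = K
      · obtain ⟨i, rfl⟩ := hK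
        have := h.mem_iff hH i
          (fun i => decide (H i ∈ L v ↔ H i ∈ L (φ fun _ => true))) fun _ => true
        rw [decide_eq_true_iff] at this
        by_cases h2 : H i ∈ L (φ fun _ => true)
        · simpa [h2] using this
        · simpa [h2, not_iff_not] using this
      · push Not at hK
        exact ((h _ _ K).2 fun i hi => absurd hi (hK i)).trans (hcon K hK).symm
    obtain ⟨K, hK, hKv⟩ := hex
    symm
    refine finprod_eq_zero _ K ?_ ?_
    · rw [coord_point_of_ne hφ h x hK fun _ => true]
      by_cases h1 : K ∈ L v
      · simp only [h1, true_iff] at hKv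
        simp [h1, hKv]
      · simp only [h1, false_iff, not_not] at hKv
        simp [h1, hKv]
    -- All other factors are `1`. With infinitely many factors different from `1` the `finprod`
    -- would have the default value `1`.
    · refine (((L v).finite_toSet.union (L (φ fun _ => true)).finite_toSet).union
        (Finset.univ.image H).finite_toSet).subset fun K' hK' => ?_
      by_contra hn
      simp only [Finset.coe_image, Finset.coe_univ, Set.image_univ, Set.mem_union, Finset.mem_coe,
        Set.mem_range, not_or, not_exists] at hn
      refine hK' ?_
      change (if _ then _ else _) = _
      rw [coord_point_of_ne hφ h x hn.2 fun _ => true]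
      simp [hn.1.1, hn.1.2]

theorem IsLabelling.ext_coord (hL : X.IsLabelling L) {p q : X.Realization}
    (h : ∀ K, coord L p K = coord L q K) : p = q := by
  ext v
  rw [hL.weight_eq, hL.weight_eq]
  simp only [h]

theorem abs_coord_sub_coord {d : ℕ} {φ : (Fin d → Bool) → V} {H : Fin d → P} (hφ : X.IsChart φ)
    (hH : Function.Injective H) (h : IsDirectionLabel L φ H) (x y : Fin d → unitInterval)
    (i : Fin d) : |coord L (X.point φ hφ x) (H i) - coord L (X.point φ hφ y) (H i)| =
      |(x i : ℝ) - (y i : ℝ)| := by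
  rw [coord_point_label hφ hH h, coord_point_label hφ hH h]
  split_ifs
  · rfl
  · rw [sub_sub_sub_cancel_left, abs_sub_comm]

theorem IsLabelling.sum_abs_le_of_cube (hL : X.IsLabelling L) {d : ℕ} {φ : (Fin d → Bool) → V}
    (hφ : X.IsChart φ) (x y : Fin d → unitInterval) (S : Finset P) :
    ∑ K ∈ S, |coord L (X.point φ hφ x) K - coord L (X.point φ hφ y) K| ≤
      ∑ i, |(x i : ℝ) - (y i : ℝ)| := by
  classical
  obtain ⟨H, hH, h⟩ := hL.exists_label hφ
  rw [← Finset.sum_congr rfl fun i _ => abs_coord_sub_coord hφ hH h x y i, ← Finset.sum_image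
    (f := fun K => |coord L (X.point φ hφ x) K - coord L (X.point φ hφ y) K|) hH.injOn]
  rw [← Finset.sum_filter_of_ne (p := fun K => K ∈ Finset.univ.image H)]
  · refine Finset.sum_le_sum_of_subset_of_nonneg (fun K hK => (Finset.mem_filter.1 hK).2)
      fun _ _ _ => abs_nonneg _
  · intro K _ hK
    by_contra hK'
    refine hK ?_
    have hne : ∀ i, H i ≠ K := by simpa using hK'
    rw [coord_point_of_ne hφ h x hne fun _ => true, coord_point_of_ne hφ h y hne fun _ => true]
    simp

/-- A chain is at least as long as the sum of the changes of the coordinates. -/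
theorem IsLabelling.sum_abs_le (hL : X.IsLabelling L) {p q : X.Realization} {r : ℝ}
    (h : X.Chain p q r) (S : Finset P) : ∑ K ∈ S, |coord L p K - coord L q K| ≤ r := by
  induction h with
  | refl p => simp
  | @step d φ hφ x y q r _ ih =>
    refine le_trans ?_ (add_le_add (hL.sum_abs_le_of_cube hφ x y S) ih)
    rw [← Finset.sum_add_distrib]
    exact Finset.sum_le_sum fun K _ => abs_sub_le _ _ _

end Coord

/-! ## Chains of minimal length -/

section

variable {P : Type v} {L : V → Finset P}

open Classical in
theorem IsDirectionLabel.exists_point {d : ℕ} {φ : (Fin d → Bool) → V}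
    {H : Fin d → P} (h : IsDirectionLabel L φ H) (hφ : X.IsChart φ) (hH : Function.Injective H)
    (b : Fin d → Bool) (g : P → ℝ) (hg : ∀ K, g K ∈ Set.Icc (0 : ℝ) 1)
    (hg' : ∀ K, (∀ i, H i ≠ K) → g K = if K ∈ L (φ b) then 1 else 0) :
    ∃ x, ∀ K, coord L (X.point φ hφ x) K = g K := by
  refine ⟨fun i => ⟨if H i ∈ L (φ fun _ => true) then g (H i) else 1 - g (H i), ?_⟩, fun K => ?_⟩
  · have := hg (H i)
    split_ifs
    · exact this
    · exact ⟨by linarith [this.2], by linarith [this.1]⟩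
  · by_cases hK : ∃ i, H i = K
    · obtain ⟨i, rfl⟩ := hK
      rw [coord_point_label hφ hH h]
      by_cases h1 : H i ∈ L (φ fun _ => true) <;> simp [h1]
    · push Not at hK
      rw [coord_point_of_ne hφ h _ hK b, hg' K hK]

theorem IsLabelling.coord_mem (hL : X.IsLabelling L) (p : X.Realization) (K : P) :
    coord L p K ∈ Set.Icc (0 : ℝ) 1 := by
  classical
  obtain ⟨w, d, φ, x, hφ, rfl⟩ := p
  change coord L (X.point φ hφ x) K ∈ _
  obtain ⟨H, hH, h⟩ := hL.exists_label hφ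
  by_cases hK : ∃ i, H i = K
  · obtain ⟨i, rfl⟩ := hK
    rw [coord_point_label hφ hH h]
    have := (x i).2
    split_ifs
    · exact this
    · exact ⟨by linarith [this.2], by linarith [this.1]⟩
  · push Not at hK
    rw [coord_point_of_ne hφ h x hK fun _ => true]
    split_ifs <;> simp

/-- Some cube that contains `p` has a direction with label `K`. -/
def Movable (L : V → Finset P) (p : X.Realization) (K : P) : Prop :=
  ∃ (d : ℕ) (φ : (Fin d → Bool) → V) (hφ : X.IsChart φ) (H : Fin d → P) (x : Fin d → unitInterval)
    (i : Fin d), Function.Injective H ∧ IsDirectionLabel L φ H ∧ p = X.point φ hφ x ∧ H i = K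

open Classical in
theorem IsLabelling.exists_move (hL : X.IsLabelling L) {p : X.Realization} {K : P}
    (h : Movable L p K) {t : ℝ} (ht : t ∈ Set.Icc (0 : ℝ) 1) :
    ∃ p' : X.Realization, X.Chain p p' |coord L p K - t| ∧
      ∀ K', coord L p' K' = Function.update (coord L p) K t K' := by
  obtain ⟨d, φ, hφ, H, x, i, hH, h, rfl, rfl⟩ := h
  obtain ⟨y, hy⟩ := h.exists_point hφ hH (fun _ => true)
    (Function.update (coord L (X.point φ hφ x)) (H i) t) (fun K => by
      by_cases hK : K = H i
      · subst hK; simpa using ht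
      · rw [Function.update_of_ne hK]
        exact hL.coord_mem _ _) (fun K hK => by
      rw [Function.update_of_ne (hK i).symm, coord_point_of_ne hφ h x hK])
  refine ⟨X.point φ hφ y, ?_, hy⟩
  have hc := Chain.step φ hφ x y (Chain.refl _)
  have hsum : (∑ j, |(x j : ℝ) - (y j : ℝ)|) = |coord L (X.point φ hφ x) (H i) - t| := by
    rw [Finset.sum_eq_single i]
    · rw [← abs_coord_sub_coord hφ hH h, hy, Function.update_self]
    · intro j _ hj
      rw [← abs_coord_sub_coord hφ hH h, hy, Function.update_of_ne (fun e => hj (hH e))]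
      simp
    · simp
  rwa [hsum, add_zero] at hc

end

/-- If `y` were farther from `w`, the edge from `y` to `x` would begin a geodesic to `w`, whose
remainder from `x` could not cross `hyp h`. -/
theorem IsCAT0.dist_eq_of_sep (hX : X.IsCAT0) (o : V) {x y w : V} (h : X.oneSkeleton.Adj x y)
    (hs : ¬(hyp h ∈ X.sep o x ↔ hyp h ∈ X.sep o w)) :
    X.oneSkeleton.dist x w = X.oneSkeleton.dist y w + 1 := by
  refine (hX.dist_eq_or h w).resolve_right fun hd => hs ?_
  obtain ⟨p, hp⟩ := hX.exists_geodesic x w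
  have hn := hX.nodup_hyps (p := SimpleGraph.Walk.cons h.symm p) (by simp [hp, hd])
  rw [hyps_cons, List.nodup_cons, hyp_symm h] at hn
  exact (hX.sep_iff o hp _).2 hn.1

/-- Rounding the coordinates of a point to obtain a vertex of the minimal cube that contains it;
`N K` is the neighbour of this vertex in the direction `K` of this cube. -/
theorem IsCAT0.exists_round (hX : X.IsCAT0) (o : V) (p : X.Realization) :
    ∃ (v : V) (F : Finset X.Hyperplane) (N : X.Hyperplane → V),
      (∀ K, K ∈ X.sep o v ↔ coord (X.sep o) p K = 1) ∧
      (∀ K, K ∈ F ↔ coord (X.sep o) p K ≠ 0 ∧ coord (X.sep o) p K ≠ 1) ∧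
      (∀ K ∈ F, Movable (X.sep o) p K) ∧
      (∀ K ∈ F, ∃ h : X.oneSkeleton.Adj v (N K), hyp h = K) ∧
      ∀ K ∈ F, ∀ K' ∈ F, K ≠ K' → ∃ c, X.IsTwoCube v (N K) c (N K') := by
  classical
  have hL := hX.isLabelling o
  obtain ⟨w, d, φ, x, hφ, rfl⟩ := p
  change ∃ (v : V) (F : Finset X.Hyperplane) (N : X.Hyperplane → V),
      (∀ K, K ∈ X.sep o v ↔ coord (X.sep o) (X.point φ hφ x) K = 1) ∧
      (∀ K, K ∈ F ↔ coord (X.sep o) (X.point φ hφ x) K ≠ 0 ∧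
        coord (X.sep o) (X.point φ hφ x) K ≠ 1) ∧
      (∀ K ∈ F, Movable (X.sep o) (X.point φ hφ x) K) ∧
      (∀ K ∈ F, ∃ h : X.oneSkeleton.Adj v (N K), hyp h = K) ∧
      ∀ K ∈ F, ∀ K' ∈ F, K ≠ K' → ∃ c, X.IsTwoCube v (N K) c (N K')
  obtain ⟨H, hH, h⟩ := hL.exists_label hφ
  set g := coord (X.sep o) (X.point φ hφ x) with hg
  -- Chosen so that `H i` belongs to the label of `φ b` exactly when the coordinate is `1`:
  -- fractional coordinates are rounded down to `0`.
  let b : Fin d → Bool := fun i => decide (g (H i) = 1 ↔ H i ∈ X.sep o (φ fun _ => true))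
  have hF : ∀ K, g K ≠ 0 ∧ g K ≠ 1 → ∃ i, H i = K := by
    intro K hK
    by_contra hcon
    push Not at hcon
    rw [hg, coord_point_of_ne hφ h x hcon b] at hK
    split_ifs at hK <;> simp at hK
  have hlab : ∀ i, hyp (hφ.adj b i) = H i := by
    intro i
    have h1 := h.flipAt b i (hyp (hφ.adj b i))
    rw [hX.sep_adj o (hφ.adj b i)] at h1
    by_contra hne
    exact h1.2 hne rfl
  refine ⟨φ b, (Finset.univ.image H).filter fun K => g K ≠ 0 ∧ g K ≠ 1,
    fun K => if hK : ∃ i, H i = K then φ (flipAt hK.choose b) else φ b, ?_, ?_, ?_, ?_, ?_⟩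
  · intro K
    by_cases hK : ∃ i, H i = K
    · obtain ⟨i, rfl⟩ := hK
      have := h.mem_iff hH i b fun _ => true
      rw [decide_eq_true_iff] at this
      by_cases h2 : H i ∈ X.sep o (φ fun _ => true)
      · simpa [h2] using this
      · simpa [h2, not_iff_not] using this
    · push Not at hK
      rw [hg, coord_point_of_ne hφ h x hK b]
      by_cases h1 : K ∈ X.sep o (φ b) <;> simp [h1]
  · intro K
    rw [Finset.mem_filter]
    refine ⟨fun h => h.2, fun hK => ⟨?_, hK⟩⟩
    obtain ⟨i, rfl⟩ := hF K hK
    simp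
  · intro K hK
    obtain ⟨i, hi⟩ := hF K (Finset.mem_filter.1 hK).2
    exact ⟨d, φ, hφ, H, x, i, hH, h, rfl, hi⟩
  · intro K hK
    have hi := hF K (Finset.mem_filter.1 hK).2
    have e := hlab hi.choose
    rw [hi.choose_spec] at e
    simp only [dif_pos hi]
    exact ⟨hφ.adj b _, e⟩
  · intro K hK K' hK' hne
    have hi := hF K (Finset.mem_filter.1 hK).2
    have hi' := hF K' (Finset.mem_filter.1 hK').2
    simp only [dif_pos hi, dif_pos hi']
    exact ⟨_, hφ.isTwoCube b fun e => hne (by rw [← hi.choose_spec, ← hi'.choose_spec, e])⟩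

/-- If two points differ, then a cube that contains one of them has a direction in which they
differ. -/
theorem IsCAT0.exists_movable (hX : X.IsCAT0) (o : V) (p q : X.Realization)
    (hpq : p ≠ q) : ∃ K, coord (X.sep o) p K ≠ coord (X.sep o) q K ∧
      (Movable (X.sep o) p K ∨ Movable (X.sep o) q K) := by
  classical
  have hL := hX.isLabelling o
  by_contra hcon
  push Not at hcon
  obtain ⟨v, F, N, hv, hF, hFm, hN, hsq⟩ := hX.exists_round o p
  obtain ⟨v', F', N', hv', hF', hFm', hN', hsq'⟩ := hX.exists_round o q
  have hFeq : ∀ K ∈ F, coord (X.sep o) p K = coord (X.sep o) q K := fun K hK => by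
    by_contra hne
    exact (hcon K hne).1 (hFm K hK)
  have hFeq' : ∀ K ∈ F', coord (X.sep o) p K = coord (X.sep o) q K := fun K hK => by
    by_contra hne
    exact (hcon K hne).2 (hFm' K hK)
  have hFF' : ∀ K ∈ F, K ∈ F' := fun K hK => by
    rw [hF', ← hFeq K hK]
    exact (hF K).1 hK
  -- The rounded vertex determines the integral coordinates, and the fractional ones agree by `hFeq`
  -- and `hFeq'`.
  have hne : v ≠ v' := by
    rintro rfl
    refine hpq (hL.ext_coord fun K => ?_)
    by_contra hne
    have h1 : K ∉ F := fun h => hne (hFeq K h)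
    have h2 : K ∉ F' := fun h => hne (hFeq' K h)
    rw [hF] at h1
    rw [hF'] at h2
    have h3 := (hv K).symm.trans (hv' K)
    by_cases h4 : coord (X.sep o) p K = 1
    · exact hne (h4.trans (h3.1 h4).symm)
    · have h5 : coord (X.sep o) q K ≠ 1 := fun h => h4 (h3.2 h)
      have h6 : coord (X.sep o) p K = 0 := by by_contra h; exact h1 ⟨h, h4⟩
      have h7 : coord (X.sep o) q K = 0 := by by_contra h; exact h2 ⟨h, h5⟩
      exact hne (h6.trans h7.symm)
  obtain ⟨w, hw⟩ := hX.exists_geodesic v v'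
  cases w with
  | nil => exact hne rfl
  | @cons _ v₁ _ e w =>
  have hsep : ¬(hyp e ∈ X.sep o v ↔ hyp e ∈ X.sep o v') := by
    rw [hX.sep_iff o hw]
    simp
  have hdiff : coord (X.sep o) p (hyp e) ≠ coord (X.sep o) q (hyp e) := by
    intro h
    rw [hv, hv', h] at hsep
    exact hsep Iff.rfl
  -- The neighbour `N' K` of `v'` is separated from `v` by both `hyp e` and `K`. So `v₁` and `N K`
  -- are both nearer to it than `v`, and the quadrangle condition gives the square.
  have hkey : ∀ K ∈ F, ∃ c, X.IsTwoCube v v₁ c (N K) := by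
    intro K hK
    obtain ⟨e₁, he₁⟩ := hN K hK
    obtain ⟨e₂, he₂⟩ := hN' K (hFF' K hK)
    have hKe : hyp e ≠ K := by
      rintro rfl
      exact hdiff (hFeq _ hK)
    have hKv : K ∉ X.sep o v := fun h => ((hF K).1 hK).2 ((hv K).1 h)
    have hKv' : K ∉ X.sep o v' := fun h => ((hF' K).1 (hFF' K hK)).2 ((hv' K).1 h)
    have h1 := (hX.sep_adj o e₂ (hyp e)).2 (by rwa [he₂])
    have h2 : ¬(K ∈ X.sep o v' ↔ K ∈ X.sep o (N' K)) := fun h =>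
      (hX.sep_adj o e₂ K).1 h he₂.symm
    obtain ⟨u, hu, -⟩ := hX.quadrangle (v := N' K) (x := v) (z := v₁) (w := N K) (by
        rintro rfl
        exact hKe he₁) e e₁
      (hX.dist_eq_of_sep o e (by rwa [← h1]))
      (hX.dist_eq_of_sep o e₁ (by
        rw [he₁]
        intro h
        exact h2 ⟨fun h3 => absurd h3 hKv', fun h3 => absurd (h.2 h3) hKv⟩))
    exact ⟨u, hu⟩
  -- Flagness yields a cube at `v` with the directions in `F` and the direction of `e`. It contains
  -- `p`, so `p` can be moved in the direction `hyp e`, in which `p` and `q` differ.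
  obtain ⟨d, φ, b, hφ, hb, -, hs⟩ := hX.2.exists_chart v (insert v₁ (F.image N)) (by
      intro y hy
      rw [Finset.mem_insert, Finset.mem_image] at hy
      rcases hy with rfl | ⟨K, hK, rfl⟩
      · exact e
      · exact (hN K hK).1) (by
      intro y hy z hz hyz
      rw [Finset.mem_insert, Finset.mem_image] at hy hz
      rcases hy with rfl | ⟨K, hK, rfl⟩ <;> rcases hz with rfl | ⟨K', hK', rfl⟩
      · exact absurd rfl hyz
      · exact hkey K' hK'
      · obtain ⟨c, hc⟩ := hkey K hK
        exact ⟨c, hc.reflect⟩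
      · exact hsq K hK K' hK' (by rintro rfl; exact hyz rfl))
  subst hb
  obtain ⟨H, hH, h⟩ := hL.exists_label hφ
  have hlab : ∀ y (e : X.oneSkeleton.Adj (φ b) y), y ∈ insert v₁ (F.image N) →
      ∃ i, H i = hyp e := by
    intro y e hy
    obtain ⟨i, rfl⟩ := hs y hy
    refine ⟨i, ?_⟩
    have h1 := h.flipAt b i (hyp e)
    rw [hX.sep_adj o e] at h1
    by_contra hne
    exact h1.2 (Ne.symm hne) rfl
  obtain ⟨x, hx⟩ := h.exists_point hφ hH b (coord (X.sep o) p) (hL.coord_mem p) (by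
    intro K hK
    have hKF : K ∉ F := by
      intro hKF
      obtain ⟨e₁, he₁⟩ := hN K hKF
      obtain ⟨i, hi⟩ := hlab _ e₁ (by
        rw [Finset.mem_insert, Finset.mem_image]
        exact Or.inr ⟨K, hKF, rfl⟩)
      exact hK i (hi.trans he₁)
    rw [hF] at hKF
    split_ifs with h1
    · exact (hv K).1 h1
    · rw [hv] at h1
      by_contra h2
      exact hKF ⟨h2, h1⟩)
  obtain ⟨i, hi⟩ := hlab v₁ e (by simp)
  exact (hcon (hyp e) hdiff).1 ⟨d, φ, hφ, H, x, i, hH, h, (hL.ext_coord hx).symm, hi⟩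

/-- Any two points are joined by a chain whose length is the sum of the changes of the
coordinates. -/
theorem IsCAT0.exists_chain (hX : X.IsCAT0) (o : V) (S : Finset X.Hyperplane)
    (p q : X.Realization) (hS : ∀ K, coord (X.sep o) p K ≠ coord (X.sep o) q K → K ∈ S) :
    X.Chain p q (∑ K ∈ S, |coord (X.sep o) p K - coord (X.sep o) q K|) := by
  classical
  have hL := hX.isLabelling o
  induction S using Finset.strongInduction generalizing p q with
  | H S ih =>
  by_cases hpq : p = q
  · subst hpq
    simpa using Chain.refl p
  have key : ∀ (p q : X.Realization) (K : X.Hyperplane),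
      (∀ K, coord (X.sep o) p K ≠ coord (X.sep o) q K → K ∈ S) →
      coord (X.sep o) p K ≠ coord (X.sep o) q K → Movable (X.sep o) p K →
      X.Chain p q (∑ K ∈ S, |coord (X.sep o) p K - coord (X.sep o) q K|) := by
    intro p q K hS hK hm
    -- The coordinate `K` of `p` is moved to its value at `q`; afterwards only the coordinates in
    -- `S.erase K` can differ.
    obtain ⟨p', hc, hp'⟩ := hL.exists_move hm (hL.coord_mem q K)
    have hrest := ih (S.erase K) (Finset.erase_ssubset (hS K hK)) p' q (by
      intro K' hK'
      rw [hp'] at hK'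
      have hne : K' ≠ K := by
        rintro rfl
        simp at hK'
      rw [Function.update_of_ne hne] at hK'
      exact Finset.mem_erase.2 ⟨hne, hS K' hK'⟩)
    have := hc.trans hrest
    rw [← Finset.add_sum_erase S _ (hS K hK)]
    convert this using 2
    refine Finset.sum_congr rfl fun K' hK' => ?_
    rw [hp', Function.update_of_ne (Finset.mem_erase.1 hK').1]
  obtain ⟨K, hK, hm | hm⟩ := hX.exists_movable o p q hpq
  · exact key p q K hS hK hm
  · have := (key q p K (fun K hK => hS K hK.symm) hK.symm hm).reverse
    simpa only [abs_sub_comm] using this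

/-! ## Isometric embeddings -/

theorem Chain.map {W : Type v} {Y : CubeComplex W} {F : X.Realization → Y.Realization}
    (hF : IsCombinatorial X Y F) {p q : X.Realization} {r : ℝ} (h : X.Chain p q r) :
    Y.Chain (F p) (F q) r := by
  obtain ⟨f, hf⟩ := hF
  induction h with
  | refl p => exact .refl _
  | step φ hφ x y _ ih =>
    obtain ⟨hfφ, h⟩ := hf _ φ hφ
    rw [h] at ih ⊢
    exact Chain.step _ hfφ x y ih

open Classical in
/-- A map of the vertices that sends charts to charts and is compatible with labellings by which
the `ℓ¹`-distances in `X` are computed induces an isometric embedding. -/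
theorem IsCAT0.isometricallyEmbeds (hX : X.IsCAT0) (o : V) {W : Type v} {Y : CubeComplex W}
    {L : W → Finset X.Hyperplane} (hL : Y.IsLabelling L) (f : V → W)
    (hf : ∀ v, L (f v) = X.sep o v)
    (hφ : ∀ {d : ℕ} {φ : (Fin d → Bool) → V}, X.IsChart φ → Y.IsChart (f ∘ φ)) :
    X.IsometricallyEmbeds Y := by
  have hcoord : ∀ {d : ℕ} {φ : (Fin d → Bool) → V} (h : X.IsChart φ) (x : Fin d → unitInterval) K,
      coord L (Y.point (f ∘ φ) (hφ h) x) K = coord (X.sep o) (X.point φ h x) K := by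
    intro d φ h x K
    rw [coord_point, coord_point]
    simp only [Function.comp_apply, hf]
  have hex : ∀ p : X.Realization, ∃ q : Y.Realization, ∀ K, coord L q K = coord (X.sep o) p K := by
    rintro ⟨w, d, φ, x, h, rfl⟩
    exact ⟨_, hcoord h x⟩
  choose F hF using hex
  have hcomb : IsCombinatorial X Y F := by
    refine ⟨f, fun d φ h => ⟨hφ h, fun x => hL.ext_coord fun K => ?_⟩⟩
    rw [hF, hcoord]
  -- Chains of `X` are mapped to chains of the same length. Conversely, a chain in `Y` is at least
  -- as long as the change of coordinates, which some chain in `X` realizes.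
  refine ⟨F, hcomb, fun p q => le_antisymm ?_ ?_⟩
  · exact le_iInf₂ fun r h => iInf₂_le r (h.map hcomb)
  · refine le_iInf₂ fun r h => ?_
    -- Nonzero coordinates are either `1`, hence in the label of the rounded vertex, or fractional.
    have hfin : ∀ p : X.Realization, ∃ S : Finset X.Hyperplane, ∀ K, coord (X.sep o) p K ≠ 0 →
        K ∈ S := by
      intro p
      obtain ⟨v, A, -, hv, hA, -⟩ := hX.exists_round o p
      refine ⟨X.sep o v ∪ A, fun K hK => ?_⟩
      rw [Finset.mem_union, hv, hA]
      by_cases h1 : coord (X.sep o) p K = 1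
      · exact Or.inl h1
      · exact Or.inr ⟨hK, h1⟩
    obtain ⟨S, hS⟩ := hfin p
    obtain ⟨S', hS'⟩ := hfin q
    have hc := hX.exists_chain o (S ∪ S') p q fun K hK => by
      rw [Finset.mem_union]
      by_contra hn
      push Not at hn
      refine hK ?_
      have h1 : coord (X.sep o) p K = 0 := by by_contra h; exact hn.1 (hS K h)
      have h2 : coord (X.sep o) q K = 0 := by by_contra h; exact hn.2 (hS' K h)
      rw [h1, h2]
    refine (iInf₂_le _ hc).trans (ENNReal.ofReal_le_ofReal ?_)
    have := hL.sum_abs_le h (S ∪ S')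
    simpa only [hF] using this

theorem IsCAT0.embedsInTrees (hX : X.IsCAT0) {k : ℕ} (h : X.crossingGraph.Colorable k) :
    X.EmbedsInTrees k := by
  obtain ⟨o⟩ := hX.1.1.nonempty
  obtain ⟨c⟩ := h
  have hc : ∀ H K, X.crossingGraph.Adj H K → c H ≠ c K := fun _ _ h => c.valid h
  exact ⟨k, le_rfl, TreeVertex X o c, colourTree X o c, fun i => hX.colourTree_isTree o hc i,
    hX.isometricallyEmbeds o isLabelling_treeLabel (toTree X o c) treeLabel_toTree
      (hX.isChart_toTree hc)⟩

theorem IsTwoCube.exists_isChart {a b c d : V} (h : X.IsTwoCube a b c d) :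
    ∃ (n : ℕ) (φ : (Fin n → Bool) → V), X.IsChart φ ∧ a ∈ Set.range φ ∧ c ∈ Set.range φ := by
  obtain ⟨n, φ, hφ, hr⟩ := X.exists_chart _ h.2.2.2.2.2.2
  exact ⟨n, φ, hφ, by rw [hr]; simp, by rw [hr]; simp⟩

/-- A combinatorial map sends charts to charts, and charts are injective. Hence edges go to edges
and the diagonal vertices of a square stay distinct, as `colorable_of_map` requires. -/
theorem IsCAT0.colorable_of_embedsInTrees (hX : X.IsCAT0) {k : ℕ} (h : X.EmbedsInTrees k) :
    X.crossingGraph.Colorable k := by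
  obtain ⟨n, hn, W, T, hT, F, ⟨f, hf⟩, -⟩ := h
  refine (hX.colorable_of_map (fun i => (hT i).isAcyclic) f (fun x y hxy => ?_)
    fun a b c d h e => ?_).mono hn
  · refine graphProduct_adj_of_pi ?_
    obtain ⟨n, φ, hφ, hr⟩ := X.exists_chart _ hxy.2
    replace hφ : X.IsChart φ := hφ
    obtain ⟨b, rfl⟩ : x ∈ Set.range φ := by rw [hr]; simp
    obtain ⟨b', rfl⟩ : y ∈ Set.range φ := by rw [hr]; simp
    obtain ⟨i, rfl⟩ := hφ.eq_flipAt hxy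
    exact (hf n φ hφ).1.adj b i
  · obtain ⟨n, φ, hφ, ⟨x, rfl⟩, y, rfl⟩ := h.exists_isChart
    exact h.1 (congrArg φ ((hf n φ hφ).1.1 e))

end CubeComplex

/-! ### Tree numbers and the chromatic number of the crossing graph -/

theorem mainTheorem3 {V : Type u} (X : CubeComplex V) (hX : X.IsCAT0) :
    (∀ k : ℕ, (X.EmbedsInTrees k ↔ X.crossingGraph.Colorable k) ∧
      (GraphEmbedsInTrees X.oneSkeleton k ↔ X.crossingGraph.Colorable k)) ∧
    X.treeNumber = X.crossingGraph.chromaticNumber ∧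
    graphTreeNumber X.oneSkeleton = X.crossingGraph.chromaticNumber := by
  have h : ∀ k : ℕ, (X.EmbedsInTrees k ↔ X.crossingGraph.Colorable k) ∧
      (GraphEmbedsInTrees X.oneSkeleton k ↔ X.crossingGraph.Colorable k) := fun k =>
    ⟨⟨hX.colorable_of_embedsInTrees, hX.embedsInTrees⟩,
      ⟨hX.colorable_of_graphEmbedsInTrees, hX.graphEmbedsInTrees⟩⟩
  refine ⟨h, ?_, ?_⟩
  · unfold CubeComplex.treeNumber SimpleGraph.chromaticNumber
    simp only [(h _).1]
    rfl
  · unfold graphTreeNumber SimpleGraph.chromaticNumber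
    simp only [(h _).2]
    rfl
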